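/- Let $\mu\in\mathbb R$ with $\mu>-\tfrac12$. Let $\Phi(a,c,z)=\sum_{k\ge 0}\frac{(a)_k}{(c)_k}\frac{z^k}{k!}$ be the confluent hypergeometric function, so that $\Phi(-m,c,x)=\sum_{k=0}^m(-1)^k\binom mk\frac{\Gamma(c)}{\Gamma(k+c)}x^k$ for $m\in\mathbb N=\{0,1,2,\dots\}$ and $c>0$. For $m\in\mathbb N$ and $x\in\mathbb R$ put $$H^\mu_{2m}(x)=(-1)^m\frac{(2m)!}{m!}\,\Phi(-m,\mu+\tfrac12,x^2),\qquad H^\mu_{2m+1}(x)=(-1)^m\frac{(2m+1)!}{m!}\,\frac{x}{\mu+\frac12}\,\Phi(-m,\mu+\tfrac32,x^2),$$ $$\gamma_\mu(2m)=\frac{2^{2m}\,m!\,\Gamma(m+\mu+\frac12)}{\Gamma(\mu+\frac12)},\qquad \gamma_\mu(2m+1)=\frac{2^{2m+1}\,m!\,\Gamma(m+\mu+\frac32)}{\Gamma(\mu+\frac12)},$$ and define $\mathbf e_\mu(z)=e^z\,\Phi(\mu,2\mu+1,-2z)$ for $z\in\mathbb C$ and the generalized Hermite functions $$\phi^\mu_n(x)=\Bigl(\frac{\gamma_\mu(n)}{\Gamma(\mu+\frac12)}\Bigr)^{1/2}\frac{1}{2^{n/2}\,n!}\,e^{-x^2/2}H^\mu_n(x),\qquad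 n\in\mathbb N,\ x\in\mathbb R .$$ Let $L^2_\mu(\mathbb R)=L^2(\mathbb R,|t|^{2\mu}dt)$ (complex-valued functions), and for $f$ in the complex linear span $\mathfrak S$ of the functions $x\mapsto x^n e^{-x^2/2}$, $n\in\mathbb N$, let $$\mathcal F_\mu f(x)=\bigl(2^{\mu+\frac12}\,\Gamma(\mu+\tfrac12)\bigr)^{-1}\int_{-\infty}^\infty \mathbf e_\mu(-ixt)\,f(t)\,|t|^{2\mu}\,dt,\qquad x\in\mathbb R .$$ Then: 1. $\{\phi^\mu_n\}_{n\in\mathbb N}$ is a complete orthonormal set in $L^2_\mu(\mathbb R)$, that is, an orthonormal family whose linear span is dense. 2. For every $n\in\mathbb N$, $\phi^\mu_n\in\mathfrak S$, the integral defining $\mathcal F_\mu\phi^\mu_n(x)$ converges absolutely for every $x\in\mathbb R$, and $\mathcal F_\mu\phi^\mu_n=(-i)^n\phi^\mu_n$. 3. (Mehler formula) For all $x,y\in\mathbb R$ and $z\in\mathbb C$ with $|z|<1$, with absolute convergence of the series, $$\sum_{n=0}^\infty\phi^\mu_n(x)\,\phi^\mu_n(y)\,z^n=\frac{1}{\Gamma(\mu+\frac12)}\,\frac{1}{(1-z^2)^{\mu+\frac12}}\exp\Bigl(-\tfrac12(x^2+y^2)\frac{1+z^2}{1-z^2}\Bigr)\,\mathbf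 e_\mu\Bigl(2xy\,\frac{z}{1-z^2}\Bigr),$$ where the power of $1-z^2$ is the principal branch. -/

import Mathlib

open MeasureTheory

noncomputable section

namespace GenHermite

/-- The confluent hypergeometric (Kummer) function
`Φ(a, c, z) = ∑_{k ≥ 0} (a)_k / (c)_k * z ^ k / k!`, where `(a)_k = a (a + 1) ⋯ (a + k - 1)`. -/
def confluent (a c z : ℂ) : ℂ :=
  ∑' k : ℕ, (ascPochhammer ℂ k).eval a / (ascPochhammer ℂ k).eval c * (z ^ k / (k.factorial : ℂ))

/-- The `m`-th confluent hypergeometric polynomial `Φ(-m, c, x)`, written as the finite sum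
`∑_{k = 0}^m (-1) ^ k * binom(m, k) * Γ(c) / Γ(k + c) * x ^ k`. -/
def confluentPoly (m : ℕ) (c x : ℝ) : ℝ :=
  ∑ k ∈ Finset.range (m + 1),
    (-1 : ℝ) ^ k * (m.choose k : ℝ) * (Real.Gamma c / Real.Gamma ((k : ℝ) + c)) * x ^ k

/-- The generalized Hermite polynomial `H_n^μ`:
`H_{2m}^μ(x) = (-1)^m (2m)!/m! * Φ(-m, μ + 1/2, x²)` and
`H_{2m+1}^μ(x) = (-1)^m (2m+1)!/m! * x / (μ + 1/2) * Φ(-m, μ + 3/2, x²)`. -/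
def hermiteH (μ : ℝ) (n : ℕ) (x : ℝ) : ℝ :=
  if Even n then
    (-1 : ℝ) ^ (n / 2) * ((n.factorial : ℝ) / ((n / 2).factorial : ℝ)) *
      confluentPoly (n / 2) (μ + 1 / 2) (x ^ 2)
  else
    (-1 : ℝ) ^ (n / 2) * ((n.factorial : ℝ) / ((n / 2).factorial : ℝ)) * (x / (μ + 1 / 2)) *
      confluentPoly (n / 2) (μ + 3 / 2) (x ^ 2)

/-- The generalized exponential function `e_μ(z) = e^z Φ(μ, 2μ + 1, -2z)`. -/
def expMu (μ : ℝ) (z : ℂ) : ℂ :=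
  Complex.exp z * confluent (μ : ℂ) (2 * (μ : ℂ) + 1) (-2 * z)

/-- The generalized factorial `γ_μ`:
`γ_μ(2m) = 2^(2m) m! Γ(m + μ + 1/2) / Γ(μ + 1/2)` and
`γ_μ(2m+1) = 2^(2m+1) m! Γ(m + μ + 3/2) / Γ(μ + 1/2)`. -/
def gammaMu (μ : ℝ) (n : ℕ) : ℝ :=
  if Even n then
    2 ^ n * ((n / 2).factorial : ℝ) * Real.Gamma (((n / 2 : ℕ) : ℝ) + μ + 1 / 2) /
      Real.Gamma (μ + 1 / 2)
  else
    2 ^ n * ((n / 2).factorial : ℝ) * Real.Gamma (((n / 2 : ℕ) : ℝ) + μ + 3 / 2) /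
      Real.Gamma (μ + 1 / 2)

/-- The generalized Hermite function
`φ_n^μ(x) = (γ_μ(n) / Γ(μ + 1/2))^(1/2) * 1 / (2^(n/2) n!) * exp(-x²/2) * H_n^μ(x)`. -/
def hermiteFun (μ : ℝ) (n : ℕ) (x : ℝ) : ℝ :=
  (gammaMu μ n / Real.Gamma (μ + 1 / 2)) ^ (1 / 2 : ℝ) *
    (1 / ((2 : ℝ) ^ ((n : ℝ) / 2) * (n.factorial : ℝ))) *
    Real.exp (-(1 / 2) * x ^ 2) * hermiteH μ n x

/-- The measure `|t|^(2μ) dt` on `ℝ`; `L²_μ(ℝ)` is `Lp ℂ 2 (weightMeasure μ)`. -/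
def weightMeasure (μ : ℝ) : Measure ℝ :=
  volume.withDensity fun t => ENNReal.ofReal (|t| ^ (2 * μ))

/-- The integrand `e_μ(-ixt) f(t) |t|^(2μ)` of the generalized Fourier transform. -/
def fourierIntegrand (μ : ℝ) (f : ℝ → ℂ) (x t : ℝ) : ℂ :=
  expMu μ (-Complex.I * (x : ℂ) * (t : ℂ)) * f t * ((|t| ^ (2 * μ) : ℝ) : ℂ)

/-- The generalized Fourier transform
`𝓕_μ f(x) = (2^(μ + 1/2) Γ(μ + 1/2))⁻¹ ∫ e_μ(-ixt) f(t) |t|^(2μ) dt`. -/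
def fourierMu (μ : ℝ) (f : ℝ → ℂ) (x : ℝ) : ℂ :=
  (((2 : ℝ) ^ (μ + 1 / 2) * Real.Gamma (μ + 1 / 2) : ℝ) : ℂ)⁻¹ *
    ∫ t : ℝ, fourierIntegrand μ f x t

/-- The domain of the generalized Fourier transform: the complex linear span of the functions
`x ↦ exp(-x²/2) x^n`, `n ∈ ℕ`. -/
def fourierDomain : Submodule ℂ (ℝ → ℂ) :=
  Submodule.span ℂ
    (Set.range fun (n : ℕ) (x : ℝ) => ((Real.exp (-(1 / 2) * x ^ 2) * x ^ n : ℝ) : ℂ))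

end GenHermite

end

noncomputable section

namespace GenHermite

open Finset (range)
open scoped Nat

/-!
Finite binomial transforms carry all of the algebra. The exponential generating function of a
binomial transform is `exp` times that of the sequence, which together with Chu–Vandermonde is
Kummer's first transformation, and applying the latter twice gives the Hille–Hardy formula. Since
`H_{2m+1}` for `μ` is `x` times `H_{2m}` for `μ + 1` up to normalization, every odd statement is
the even one at `μ + 1`; the Mehler formula adds the two Hille–Hardy formulas, the two Bessel series
being the even and odd parts of `e_μ`.

The power series of `e_μ` has coefficients `1 / γ_μ(n)` by Kummer's quadratic transformation, so
`e_μ` has exponential type and may be integrated term by term against Gaussian-decaying functions: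
the Fourier transform of `φ_n` is read off its moments. The same argument for `exp` in place of
`e_μ` shows that moments determine functions that decay this fast, whence completeness.
-/

/-- The rising factorial (Pochhammer symbol) `(c)_k = c (c + 1) ⋯ (c + k - 1)`. -/
def risingFactorial {R : Type*} [Semiring R] (c : R) (k : ℕ) : R :=
  (ascPochhammer R k).eval c

section RisingFactorial

variable {R : Type*}

lemma risingFactorial_zero [Semiring R] (c : R) : risingFactorial c 0 = 1 := by
  simp [risingFactorial]

lemma risingFactorial_succ [Semiring R] (c : R) (k : ℕ) :
    risingFactorial c (k + 1) = risingFactorial c k * (c + k) :=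
  ascPochhammer_succ_eval k c

variable [CommSemiring R]

lemma risingFactorial_add (c : R) (m n : ℕ) :
    risingFactorial c (m + n) = risingFactorial c m * risingFactorial (c + m) n := by
  simp [risingFactorial, ← ascPochhammer_mul]

lemma risingFactorial_succ_left (c : R) (k : ℕ) :
    risingFactorial c (k + 1) = c * risingFactorial (c + 1) k := by
  rw [add_comm k, risingFactorial_add]
  simp [risingFactorial]

lemma map_risingFactorial {S : Type*} [CommSemiring S] (f : R →+* S) (c : R) (k : ℕ) :
    f (risingFactorial c k) = risingFactorial (f c) k := by
  induction k with
  | zero => simp only [risingFactorial_zero, map_one]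
  | succ k ih => simp only [risingFactorial_succ, map_mul, ih, map_add, map_natCast]

lemma risingFactorial_pos [PartialOrder R] [IsStrictOrderedRing R] {c : R} (hc : 0 < c) (k : ℕ) :
    0 < risingFactorial c k :=
  ascPochhammer_pos k c hc

@[simp, norm_cast]
lemma ofReal_risingFactorial (c : ℝ) (k : ℕ) :
    ((risingFactorial c k : ℝ) : ℂ) = risingFactorial (c : ℂ) k :=
  map_risingFactorial Complex.ofRealHom c k

lemma risingFactorial_ofReal_ne_zero {c : ℝ} (hc : 0 < c) (k : ℕ) :
    risingFactorial (c : ℂ) k ≠ 0 := by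
  exact_mod_cast (risingFactorial_pos hc k).ne'

lemma risingFactorial_mul_risingFactorial_add (c : R) (m q : ℕ) :
    risingFactorial c m * risingFactorial (c + m) q =
      risingFactorial c q * risingFactorial (c + q) m := by
  rw [← risingFactorial_add, add_comm m, risingFactorial_add]

lemma Gamma_add_natCast {c : ℝ} (hc : 0 < c) (k : ℕ) :
    Real.Gamma (c + k) = Real.Gamma c * risingFactorial c k := by
  induction k with
  | zero => simp [risingFactorial_zero]
  | succ k ih =>
    rw [Nat.cast_succ, ← add_assoc, Real.Gamma_add_one (by positivity), ih, risingFactorial_succ]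
    ring

end RisingFactorial

/-- The binomial transform `n ↦ ∑_{k ≤ n} (n choose k) a_k` of a sequence. -/
def binomialTransform {R : Type*} [Semiring R] (a : ℕ → R) (n : ℕ) : R :=
  ∑ k ∈ range (n + 1), n.choose k * a k

section BinomialTransform

variable {R : Type*}

section Semiring

variable [Semiring R]

lemma binomialTransform_zero (a : ℕ → R) : binomialTransform a 0 = a 0 := by
  simp [binomialTransform]

lemma binomialTransform_eq_sum_range (a : ℕ → R) {n N : ℕ} (h : n ≤ N) :
    binomialTransform a n = ∑ k ∈ range (N + 1), n.choose k * a k := by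
  refine Finset.sum_subset (Finset.range_subset_range.2 (by lia)) fun k _ hk => ?_
  rw [Nat.choose_eq_zero_of_lt (by simpa using hk), Nat.cast_zero, zero_mul]

lemma binomialTransform_congr {a b : ℕ → R} {n : ℕ} (h : ∀ k ≤ n, a k = b k) :
    binomialTransform a n = binomialTransform b n :=
  Finset.sum_congr rfl fun k hk => by rw [h k (Finset.mem_range_succ_iff.1 hk)]

lemma binomialTransform_add (a b : ℕ → R) (n : ℕ) :
    binomialTransform (fun k => a k + b k) n = binomialTransform a n + binomialTransform b n := by
  simp only [binomialTransform, mul_add, Finset.sum_add_distrib]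

end Semiring

variable [CommSemiring R]

lemma binomialTransform_const_mul (r : R) (a : ℕ → R) (n : ℕ) :
    binomialTransform (fun k => r * a k) n = r * binomialTransform a n := by
  simp only [binomialTransform, Finset.mul_sum, mul_left_comm]

lemma binomialTransform_succ (a : ℕ → R) (n : ℕ) :
    binomialTransform a (n + 1) =
      binomialTransform a n + binomialTransform (fun k => a (k + 1)) n := by
  rw [binomialTransform_eq_sum_range a n.le_succ]
  simp only [binomialTransform, Finset.sum_range_succ' _ (n + 1), Nat.choose_succ_succ',
    Nat.cast_add, add_mul, Finset.sum_add_distrib, Nat.choose_zero_right]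
  ring

lemma binomialTransform_natCast_mul_succ (a : ℕ → R) (n : ℕ) :
    binomialTransform (fun k => k * a k) (n + 1) =
      (n + 1) * binomialTransform (fun k => a (k + 1)) n := by
  simp only [binomialTransform, Finset.sum_range_succ' _ (n + 1), Nat.cast_zero, zero_mul,
    mul_zero, add_zero, Finset.mul_sum]
  refine Finset.sum_congr rfl fun k _ => ?_
  have absorption := congrArg (Nat.cast (R := R)) (Nat.add_one_mul_choose_eq n k)
  push_cast at absorption ⊢
  rw [← mul_assoc, ← mul_assoc, absorption]

lemma binomialTransform_pow_mul_binomialTransform (r : R) (a : ℕ → R) (m : ℕ) :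
    binomialTransform (fun i => r ^ i * binomialTransform a i) m =
      binomialTransform (fun l => r ^ l * (1 + r) ^ (m - l) * a l) m := by
  induction m generalizing a with
  | zero => simp [binomialTransform_zero]
  | succ m ih =>
    have hleft : binomialTransform (fun l => r ^ l * (1 + r) ^ (m + 1 - l) * a l) m =
        (1 + r) * binomialTransform (fun l => r ^ l * (1 + r) ^ (m - l) * a l) m := by
      rw [← binomialTransform_const_mul]
      refine binomialTransform_congr fun l hl => ?_
      rw [Nat.succ_sub hl, pow_succ]
      ring
    have hright : binomialTransform
          (fun l => r ^ (l + 1) * (1 + r) ^ (m + 1 - (l + 1)) * a (l + 1)) m =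
        r * binomialTransform (fun l => r ^ l * (1 + r) ^ (m - l) * a (l + 1)) m := by
      rw [← binomialTransform_const_mul]
      refine binomialTransform_congr fun l _ => ?_
      rw [Nat.add_sub_add_right, pow_succ]
      ring
    rw [binomialTransform_succ, binomialTransform_succ, hleft, hright, ← ih a,
      ← ih fun l => a (l + 1)]
    simp only [binomialTransform_succ a, pow_succ', mul_add, mul_assoc, binomialTransform_add,
      binomialTransform_const_mul]
    ring

lemma binomialTransform_binomialTransform_neg_one {R : Type*} [CommRing R] (a : ℕ → R) (m : ℕ) :
    binomialTransform (fun i => (-1) ^ i * binomialTransform a i) m = (-1) ^ m * a m := by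
  rw [binomialTransform_pow_mul_binomialTransform, binomialTransform,
    Finset.sum_eq_single_of_mem m (Finset.self_mem_range_succ m)]
  · simp
  · intro l hl hlm
    have : m - l ≠ 0 := by have := Finset.mem_range_succ_iff.1 hl; lia
    simp [this]

lemma binomialTransform_descFactorial_comm (a : ℕ → R) (m q : ℕ) :
    binomialTransform (fun l => (q.descFactorial l : R) * a l) m =
      binomialTransform (fun l => (m.descFactorial l : R) * a l) q := by
  rw [binomialTransform_eq_sum_range _ (le_max_left m q),
    binomialTransform_eq_sum_range _ (le_max_right m q)]
  refine Finset.sum_congr rfl fun l _ => ?_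
  simp only [Nat.descFactorial_eq_factorial_mul_choose]
  push_cast
  ring

lemma chu_vandermonde {K : Type*} [Field K] {c : K}
    (hc : ∀ k, risingFactorial c k ≠ 0) (i q : ℕ) :
    risingFactorial (c + i) q / risingFactorial c q =
      binomialTransform (fun l => i.descFactorial l / risingFactorial c l) q := by
  induction q generalizing c i with
  | zero => simp [binomialTransform_zero, risingFactorial_zero]
  | succ q ih =>
    have hc1 (k : ℕ) : risingFactorial (c + 1) k ≠ 0 :=
      right_ne_zero_of_mul (risingFactorial_succ_left c k ▸ hc (k + 1))
    have hshift : binomialTransform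
        (fun l => (i.descFactorial (l + 1) : K) / risingFactorial c (l + 1)) q =
          i * risingFactorial (c + i) q / risingFactorial c (q + 1) := by
      cases i with
      | zero => simp [binomialTransform]
      | succ i =>
        have := ih hc1 i
        simp only [risingFactorial_succ_left c, Nat.succ_descFactorial_succ, Nat.cast_mul,
          mul_div_mul_comm, binomialTransform_const_mul, ← this]
        push_cast
        rw [add_right_comm, add_assoc]
    have hcq := right_ne_zero_of_mul (risingFactorial_succ c q ▸ hc (q + 1))
    rw [binomialTransform_succ, ← ih hc, hshift, risingFactorial_succ, risingFactorial_succ]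
    have := hc q
    field_simp
    ring

end BinomialTransform

section GeneratingFunctions

lemma one_le_risingFactorial_add_one {c : ℝ} (hc : 0 ≤ c) (k : ℕ) :
    1 ≤ risingFactorial (c + 1) k := by
  induction k with
  | zero => rw [risingFactorial_zero]
  | succ k ih =>
    rw [risingFactorial_succ]
    exact one_le_mul_of_one_le_of_one_le ih (by linarith [k.cast_nonneg (α := ℝ)])

lemma norm_risingFactorial_le {a : ℂ} {b : ℝ} (hab : ‖a‖ ≤ b) (k : ℕ) :
    ‖risingFactorial a k‖ ≤ risingFactorial b k := by
  induction k with
  | zero => simp [risingFactorial_zero]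
  | succ k ih =>
    rw [risingFactorial_succ, risingFactorial_succ, norm_mul]
    refine mul_le_mul ih ?_ (norm_nonneg _) ((norm_nonneg _).trans ih)
    exact (norm_add_le _ _).trans (by simpa using hab)

lemma one_sub_ne_zero_of_norm_lt_one {w : ℂ} (hw : ‖w‖ < 1) : 1 - w ≠ 0 :=
  sub_ne_zero.2 fun h => by simp [← h] at hw

lemma hasSum_of_odd_eq_zero {M : Type*} [AddCommMonoid M] [TopologicalSpace M] [ContinuousAdd M]
    {f : ℕ → M} {a : M} (hodd : ∀ q, f (2 * q + 1) = 0)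
    (heven : HasSum (fun q => f (2 * q)) a) : HasSum f a := by
  have hzero : HasSum (fun q => f (2 * q + 1)) 0 := by
    simpa only [hodd] using hasSum_zero
  simpa only [add_zero] using heven.even_add_odd hzero

lemma hasSum_of_even_eq_zero {M : Type*} [AddCommMonoid M] [TopologicalSpace M] [ContinuousAdd M]
    {f : ℕ → M} {a : M} (heven : ∀ q, f (2 * q) = 0)
    (hodd : HasSum (fun q => f (2 * q + 1)) a) : HasSum f a := by
  have hzero : HasSum (fun q => f (2 * q)) 0 := by
    simpa only [heven] using hasSum_zero
  simpa only [zero_add] using hzero.even_add_odd hodd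

lemma hasSum_swap_of_norm_le {ι κ : Type*} {f : ι → κ → ℂ} {F : ι → κ → ℝ} {R r : ι → ℂ}
    {g : κ → ℂ} {S : ℂ} (hfF : ∀ i k, ‖f i k‖ ≤ F i k)
    (hFR : ∀ i, HasSum (fun k => (F i k : ℂ)) (R i)) (hR : Summable R)
    (hr : ∀ i, HasSum (f i) (r i)) (hS : HasSum r S)
    (hg : ∀ k, HasSum (fun i => f i k) (g k)) : HasSum g S := by
  have hF_row (i : ι) : Summable (F i) := Complex.summable_ofReal.1 (hFR i).summable
  have hR_eq (i : ι) : R i = ((∑' k, F i k : ℝ) : ℂ) := by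
    rw [Complex.ofReal_tsum, (hFR i).tsum_eq]
  have hF : Summable fun p : ι × κ => F p.1 p.2 := by
    refine (summable_prod_of_nonneg fun p => (norm_nonneg _).trans (hfF p.1 p.2)).2
      ⟨hF_row, Complex.summable_ofReal.1 ?_⟩
    exact (summable_congr hR_eq).1 hR
  have hf : Summable fun p : ι × κ => f p.1 p.2 := hF.of_norm_bounded fun p => hfF p.1 p.2
  have hsum := hf.hasSum
  rw [(hsum.prod_fiberwise hr).unique hS] at hsum
  exact HasSum.prod_fiberwise ((Equiv.prodComm κ ι).hasSum_iff.2 hsum) hg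

lemma hasSum_exp_mul_binomialTransform {a : ℕ → ℂ} {s A : ℂ}
    (hA : HasSum (fun l => s ^ l / l ! * a l) A) :
    HasSum (fun m => s ^ m / m ! * binomialTransform a m) (Complex.exp s * A) := by
  have hexp : HasSum (fun l => s ^ l / l !) (Complex.exp s) := by
    rw [Complex.exp_eq_exp_ℂ]
    exact NormedSpace.expSeries_div_hasSum_exp s
  have cauchy := hasSum_sum_range_mul_of_summable_norm hA.summable.norm hexp.summable.norm
  rw [hA.tsum_eq, hexp.tsum_eq, mul_comm] at cauchy
  refine cauchy.congr_fun fun m => ?_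
  rw [binomialTransform, Finset.mul_sum]
  refine Finset.sum_congr rfl fun l hl => ?_
  have hlm := Finset.mem_range_succ_iff.1 hl
  have := m.factorial_ne_zero
  rw [Nat.cast_choose ℂ hlm, ← pow_mul_pow_sub s hlm]
  field_simp

lemma hasSum_pow_div_factorial_mul_descFactorial (s : ℂ) (b : ℕ → ℂ) (m : ℕ) :
    HasSum (fun l => s ^ l / l ! * (m.descFactorial l * b l))
      (binomialTransform (fun l => s ^ l * b l) m) := by
  have hterm (l : ℕ) :
      s ^ l / l ! * (m.descFactorial l * b l) = m.choose l * (s ^ l * b l) := by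
    have := l.factorial_ne_zero
    rw [Nat.descFactorial_eq_factorial_mul_choose]
    push_cast
    field_simp
  simp only [hterm]
  refine hasSum_sum_of_ne_finset_zero fun l hl => ?_
  rw [Nat.choose_eq_zero_of_lt (by simpa using hl), Nat.cast_zero, zero_mul]

lemma hasSum_risingFactorial_mul_pow (a : ℂ) {w : ℂ} (hw : ‖w‖ < 1) :
    HasSum (fun n => risingFactorial a n / n ! * w ^ n) (1 / (1 - w) ^ a) := by
  have h := (Complex.one_div_one_sub_cpow_hasFPowerSeriesOnBall_zero a).hasSum (y := w)
    (by rw [mem_eball_zero_iff, ← ofReal_norm, ENNReal.ofReal_lt_one]; exact hw)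
  rw [zero_add] at h
  refine h.congr_fun fun n => ?_
  have hchoose := Ring.factorial_nsmul_multichoose_eq_ascPochhammer a n
  rw [Polynomial.ascPochhammer_smeval_eq_eval, nsmul_eq_mul, Ring.multichoose_eq] at hchoose
  rw [FormalMultilinearSeries.ofScalars_apply_eq, smul_eq_mul, risingFactorial, ← hchoose,
    mul_div_cancel_left₀ _ (mod_cast n.factorial_ne_zero)]

lemma hasSum_risingFactorial_mul_choose_mul_pow (a : ℂ) {w : ℂ} (hw : ‖w‖ < 1) (l : ℕ) :
    HasSum (fun n => risingFactorial a n / n ! * w ^ n * n.choose l)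
      (1 / (1 - w) ^ a * (risingFactorial a l / l ! * (w / (1 - w)) ^ l)) := by
  have hw1 := one_sub_ne_zero_of_norm_lt_one hw
  have hshift := (hasSum_risingFactorial_mul_pow (a + l) hw).mul_left
    (risingFactorial a l / l ! * w ^ l)
  rw [← hasSum_nat_add_iff' l, Finset.sum_eq_zero fun n hn => ?_, sub_zero]
  · have hvalue : 1 / (1 - w) ^ a * (risingFactorial a l / l ! * (w / (1 - w)) ^ l) =
        risingFactorial a l / l ! * w ^ l * (1 / (1 - w) ^ (a + l)) := by
      rw [Complex.cpow_add _ _ hw1, Complex.cpow_natCast, div_pow]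
      field_simp
    rw [hvalue]
    refine hshift.congr_fun fun k => ?_
    have := (k + l).factorial_ne_zero
    rw [Nat.cast_choose ℂ (Nat.le_add_left l k), Nat.add_sub_cancel, risingFactorial_add,
      risingFactorial_mul_risingFactorial_add, pow_add]
    field_simp
  · rw [Nat.choose_eq_zero_of_lt (Finset.mem_range.1 hn), Nat.cast_zero, mul_zero]

lemma hasSum_risingFactorial_mul_binomialTransform {α w A : ℂ} {a : ℕ → ℂ} (hw : ‖w‖ < 1)
    (habs : Summable fun l => risingFactorial ‖α‖ l / l ! * (‖w‖ / (1 - ‖w‖)) ^ l * ‖a l‖)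
    (hA : HasSum (fun l => risingFactorial α l / l ! * (w / (1 - w)) ^ l * a l) A) :
    HasSum (fun n => risingFactorial α n / n ! * w ^ n * binomialTransform a n)
      (1 / (1 - w) ^ α * A) := by
  have hw' : ‖(‖w‖ : ℂ)‖ < 1 := by simpa using hw
  refine hasSum_swap_of_norm_le
    (f := fun l n => risingFactorial α n / n ! * w ^ n * n.choose l * a l)
    (F := fun l n => risingFactorial ‖α‖ n / n ! * ‖w‖ ^ n * n.choose l * ‖a l‖)
    (R := fun l => 1 / (1 - (‖w‖ : ℂ)) ^ (‖α‖ : ℂ) *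
      ((risingFactorial ‖α‖ l / l ! * (‖w‖ / (1 - ‖w‖)) ^ l * ‖a l‖ : ℝ) : ℂ))
    (fun l n => ?_) (fun l => ?_) ((Complex.summable_ofReal.2 habs).mul_left _)
    (fun l => ((hasSum_risingFactorial_mul_choose_mul_pow α hw l).mul_right (a l)))
    ((hA.mul_left (1 / (1 - w) ^ α)).congr_fun fun l => ?_) (fun n => ?_)
  · simp only [norm_mul, norm_div, norm_pow, Complex.norm_natCast]
    gcongr
    exact norm_risingFactorial_le le_rfl n
  · have hrow := (hasSum_risingFactorial_mul_choose_mul_pow (‖α‖ : ℂ) hw' l).mul_right (‖a l‖ : ℂ)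
    push_cast
    simpa only [mul_assoc] using hrow
  · ring
  · rw [binomialTransform, Finset.mul_sum]
    simp only [← mul_assoc]
    refine hasSum_sum_of_ne_finset_zero fun l hl => ?_
    rw [Nat.choose_eq_zero_of_lt (by simpa using hl), Nat.cast_zero, mul_zero, zero_mul]

end GeneratingFunctions

/-- The Kummer polynomial `Φ(-m, c, x)`, written through the rising factorial so that it makes
sense over any field. -/
def kummerPoly {K : Type*} [Field K] (c x : K) (m : ℕ) : K :=
  binomialTransform (fun k => (-x) ^ k / risingFactorial c k) m

/-- The normalized Bessel-type series `₀F₁(; c; s) = ∑ₖ s ^ k / (k! (c)_k)`. -/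
def besselSeries (c s : ℂ) : ℂ :=
  ∑' k : ℕ, s ^ k / (k ! * risingFactorial c k)

section HilleHardy

@[simp, norm_cast]
lemma ofReal_kummerPoly (c x : ℝ) (m : ℕ) :
    ((kummerPoly c x m : ℝ) : ℂ) = kummerPoly (c : ℂ) x m := by
  simp [kummerPoly, binomialTransform]

lemma norm_kummerPoly_le {c : ℝ} (hc : 0 < c) (x : ℂ) (m : ℕ) :
    ‖kummerPoly (c : ℂ) x m‖ ≤ kummerPoly c (-‖x‖) m := by
  refine (norm_sum_le (range (m + 1)) _).trans_eq (Finset.sum_congr rfl fun k _ => ?_)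
  simp only [← ofReal_risingFactorial, norm_mul, norm_div, norm_pow, norm_neg, neg_neg,
    Complex.norm_natCast, Complex.norm_real, Real.norm_of_nonneg (risingFactorial_pos hc k).le]

variable {c : ℝ}

lemma norm_ofReal_add_natCast (hc : 0 ≤ c) (q : ℕ) : ‖(c + q : ℂ)‖ = c + q := by
  rw [← Complex.ofReal_natCast, ← Complex.ofReal_add, Complex.norm_real,
    Real.norm_of_nonneg (by positivity)]

lemma kummer_first_transformation (hc : 0 < c) (i : ℕ) (s : ℂ) :
    HasSum (fun q => s ^ q / q ! * (risingFactorial (c + i : ℂ) q / risingFactorial (c : ℂ) q))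
      (Complex.exp s * kummerPoly (c : ℂ) (-s) i) := by
  simp only [chu_vandermonde (risingFactorial_ofReal_ne_zero hc) i]
  refine hasSum_exp_mul_binomialTransform ?_
  simpa only [kummerPoly, neg_neg, div_eq_mul_inv] using
    hasSum_pow_div_factorial_mul_descFactorial s (fun l => (risingFactorial (c : ℂ) l)⁻¹) i

lemma summable_pow_mul_div_risingFactorial (hc : 0 < c) {b : ℕ → ℂ} {i : ℕ}
    (hb : ∀ k, ‖b k‖ ≤ risingFactorial (c + i) k) (s : ℂ) :
    Summable fun k => s ^ k / k ! * (b k / risingFactorial (c : ℂ) k) := by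
  have hdom : Summable fun k =>
      ‖s‖ ^ k / k ! * (risingFactorial (c + i) k / risingFactorial c k) := by
    have hsum := (kummer_first_transformation hc i (‖s‖ : ℂ)).summable
    exact Complex.summable_ofReal.1 (hsum.congr fun k => by push_cast; rfl)
  refine hdom.of_norm_bounded fun k => ?_
  rw [norm_mul, norm_div, norm_div, norm_pow, Complex.norm_natCast, ← ofReal_risingFactorial,
    Complex.norm_real, Real.norm_of_nonneg (risingFactorial_pos hc k).le]
  have := risingFactorial_pos hc k
  gcongr
  exact hb k

lemma hasSum_besselSeries (hc : 0 < c) (s : ℂ) :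
    HasSum (fun k => s ^ k / (k ! * risingFactorial (c : ℂ) k)) (besselSeries c s) := by
  refine Summable.hasSum ((summable_pow_mul_div_risingFactorial hc (b := fun _ => 1) (i := 1)
    (fun k => ?_) s).congr fun k => ?_)
  · simpa using one_le_risingFactorial_add_one hc.le k
  · rw [mul_one_div, div_div]

lemma hasSum_pow_mul_kummerPoly (hc : 0 < c) (s v : ℂ) :
    HasSum (fun q => s ^ q / q ! * kummerPoly (c : ℂ) v q)
      (Complex.exp s * besselSeries c (-(s * v))) := by
  refine hasSum_exp_mul_binomialTransform ((hasSum_besselSeries hc _).congr_fun fun l => ?_)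
  rw [← mul_neg, mul_pow, div_mul_div_comm]

lemma hasSum_risingFactorial_add_mul_kummerPoly (hc : 0 < c) (q : ℕ) (x : ℂ) {w : ℂ}
    (hw : ‖w‖ < 1) :
    HasSum (fun m => risingFactorial (c + q : ℂ) m / m ! * w ^ m * kummerPoly (c : ℂ) x m)
      (1 / (1 - w) ^ (c + q : ℂ) *
        (Complex.exp (-(x * (w / (1 - w)))) * kummerPoly (c : ℂ) (x * (w / (1 - w))) q)) := by
  refine hasSum_risingFactorial_mul_binomialTransform hw ?_ ?_
  · have habs := kummer_first_transformation hc q (‖w‖ / (1 - ‖w‖) * ‖x‖ : ℝ)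
    refine Complex.summable_ofReal.1 (habs.summable.congr fun l => ?_)
    rw [norm_ofReal_add_natCast hc.le, norm_div, norm_pow, norm_neg,
      ← ofReal_risingFactorial c, Complex.norm_real,
      Real.norm_of_nonneg (risingFactorial_pos hc l).le]
    push_cast
    rw [mul_pow]
    ring
  · have h := kummer_first_transformation hc q (-(x * (w / (1 - w))))
    rw [neg_neg] at h
    refine h.congr_fun fun l => ?_
    rw [← neg_mul, mul_pow]
    ring

lemma hasSum_pow_mul_cpow_mul_kummerPoly (hc : 0 < c) (x y : ℂ) {w : ℂ} (hw : ‖w‖ < 1) :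
    HasSum (fun q => (-y) ^ q / q ! * (1 / (1 - w) ^ (c + q : ℂ) *
        (Complex.exp (-(x * (w / (1 - w)))) * kummerPoly (c : ℂ) (x * (w / (1 - w))) q)))
      (1 / (1 - w) ^ (c : ℂ) * Complex.exp (-(x * (w / (1 - w)))) *
        (Complex.exp (-y / (1 - w)) * besselSeries c (x * y * w / (1 - w) ^ 2))) := by
  have hw1 := one_sub_ne_zero_of_norm_lt_one hw
  have h := (hasSum_pow_mul_kummerPoly hc (-y / (1 - w)) (x * (w / (1 - w)))).mul_left
    (1 / (1 - w) ^ (c : ℂ) * Complex.exp (-(x * (w / (1 - w)))))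
  have harg : -(-y / (1 - w) * (x * (w / (1 - w)))) = x * y * w / (1 - w) ^ 2 := by
    field_simp
  rw [harg] at h
  refine h.congr_fun fun q => ?_
  rw [Complex.cpow_add _ _ hw1, Complex.cpow_natCast, div_pow]
  ring

lemma hasSum_pow_mul_risingFactorial_add (hc : 0 < c) (m : ℕ) (y : ℂ) :
    HasSum (fun q => (-y) ^ q / q ! * risingFactorial (c + q : ℂ) m)
      (risingFactorial (c : ℂ) m * (Complex.exp (-y) * kummerPoly (c : ℂ) y m)) := by
  have h := kummer_first_transformation hc m (-y)
  rw [neg_neg] at h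
  refine (h.mul_left _).congr_fun fun q => ?_
  have := risingFactorial_ofReal_ne_zero hc q
  field_simp
  linear_combination (-y) ^ q / q ! * risingFactorial_mul_risingFactorial_add (c : ℂ) q m

/-- Expanding the second polynomial by Kummer's transformation makes the sum over `m` a generating
function of the same kind, because `(c)_m (c + m)_q = (c)_q (c + q)_m`. -/
lemma hille_hardy (hc : 0 < c) (x y : ℂ) {w : ℂ} (hw : ‖w‖ < 1) :
    HasSum (fun m => risingFactorial (c : ℂ) m / m ! * w ^ m *
        (kummerPoly (c : ℂ) x m * kummerPoly (c : ℂ) y m))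
      (1 / (1 - w) ^ (c : ℂ) * Complex.exp (-((x + y) * (w / (1 - w)))) *
        besselSeries c (x * y * w / (1 - w) ^ 2)) := by
  have hw1 := one_sub_ne_zero_of_norm_lt_one hw
  let f (q m : ℕ) : ℂ :=
    (-y) ^ q / q ! * (risingFactorial (c + q : ℂ) m / m ! * w ^ m * kummerPoly (c : ℂ) x m)
  have hrow (x y : ℂ) {w : ℂ} (hw : ‖w‖ < 1) (q : ℕ) :=
    (hasSum_risingFactorial_add_mul_kummerPoly hc q x hw).mul_left ((-y) ^ q / q ! : ℂ)
  have hcol (m : ℕ) : HasSum (fun q => f q m)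
      (w ^ m / m ! * kummerPoly (c : ℂ) x m *
        (risingFactorial (c : ℂ) m * (Complex.exp (-y) * kummerPoly (c : ℂ) y m))) :=
    ((hasSum_pow_mul_risingFactorial_add hc m y).mul_left _).congr_fun fun q => by ring
  have hbound (q m : ℕ) : ‖f q m‖ ≤ ‖y‖ ^ q / q ! *
      (risingFactorial (c + q) m / m ! * ‖w‖ ^ m * kummerPoly c (-‖x‖) m) := by
    simp only [f, norm_mul, norm_div, norm_pow, norm_neg, Complex.norm_natCast]
    have := risingFactorial_pos (add_pos_of_pos_of_nonneg hc q.cast_nonneg) m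
    gcongr
    · exact norm_risingFactorial_le (norm_ofReal_add_natCast hc.le q).le m
    · exact norm_kummerPoly_le hc x m
  have hw' : ‖(‖w‖ : ℂ)‖ < 1 := by simpa using hw
  have hmain := hasSum_swap_of_norm_le hbound
    (fun q => by simpa using hrow (-‖x‖ : ℂ) (-‖y‖) hw' q)
    (hasSum_pow_mul_cpow_mul_kummerPoly hc (-‖x‖ : ℂ) (-‖y‖) hw').summable
    (hrow x y hw) (hasSum_pow_mul_cpow_mul_kummerPoly hc x y hw) hcol
  have hvalue : 1 / (1 - w) ^ (c : ℂ) * Complex.exp (-((x + y) * (w / (1 - w)))) =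
      Complex.exp y * (1 / (1 - w) ^ (c : ℂ) * Complex.exp (-(x * (w / (1 - w)))) *
        Complex.exp (-y / (1 - w))) := by
    have : -((x + y) * (w / (1 - w))) = y + (-(x * (w / (1 - w))) + -y / (1 - w)) := by
      field_simp
      ring
    rw [this, Complex.exp_add, Complex.exp_add]
    ring
  rw [hvalue, mul_assoc, mul_assoc _ (Complex.exp _)]
  refine (hmain.mul_left (Complex.exp y)).congr_fun fun m => ?_
  have hexp : Complex.exp y * Complex.exp (-y) = 1 := by rw [← Complex.exp_add]; simp
  linear_combination -(risingFactorial (c : ℂ) m / m ! * w ^ m *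
    (kummerPoly (c : ℂ) x m * kummerPoly (c : ℂ) y m)) * hexp

end HilleHardy

section GeneralizedExponential

variable {μ : ℝ}

lemma gammaMu_two_mul (hμ : -(1 / 2) < μ) (m : ℕ) :
    gammaMu μ (2 * m) = 2 ^ (2 * m) * m ! * risingFactorial (μ + 1 / 2) m := by
  have hc : 0 < μ + 1 / 2 := by linarith
  rw [gammaMu, if_pos (even_two_mul m), Nat.mul_div_cancel_left m two_pos, add_assoc,
    add_comm (m : ℝ), Gamma_add_natCast hc]
  rw [mul_left_comm, mul_div_cancel_left₀ _ (Real.Gamma_pos_of_pos hc).ne']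

lemma gammaMu_two_mul_add_one (hμ : -(1 / 2) < μ) (m : ℕ) :
    gammaMu μ (2 * m + 1) = (2 * μ + 1) * gammaMu (μ + 1) (2 * m) := by
  have hc : 0 < μ + 1 / 2 := by linarith
  have hdiv : (2 * m + 1) / 2 = m := by lia
  have hΓ : Real.Gamma (m + μ + 3 / 2) =
      Real.Gamma (μ + 1 / 2) * (μ + 1 / 2) * risingFactorial (μ + 1 + 1 / 2) m := by
    rw [show (m : ℝ) + μ + 3 / 2 = μ + 1 / 2 + 1 + m by ring, Gamma_add_natCast (by positivity),
      Real.Gamma_add_one hc.ne', add_right_comm, mul_comm (μ + 1 / 2)]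
  rw [gammaMu_two_mul (by linarith), gammaMu, if_neg (Nat.not_even_two_mul_add_one m), hdiv, hΓ,
    mul_assoc (Real.Gamma _), mul_left_comm, mul_div_cancel_left₀ _ (Real.Gamma_pos_of_pos hc).ne']
  ring

lemma gammaMu_zero (hμ : -(1 / 2) < μ) : gammaMu μ 0 = 1 := by
  simpa [risingFactorial_zero] using gammaMu_two_mul hμ 0

lemma gammaMu_succ_of_even (hμ : -(1 / 2) < μ) {n : ℕ} (hn : Even n) :
    gammaMu μ (n + 1) = (n + 1 + 2 * μ) * gammaMu μ n := by
  obtain ⟨m, rfl⟩ := hn.two_dvd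
  have hshift : (μ + 1 / 2) * risingFactorial (μ + 1 + 1 / 2) m =
      risingFactorial (μ + 1 / 2) m * (μ + 1 / 2 + m) := by
    rw [← risingFactorial_succ, risingFactorial_succ_left, add_right_comm]
  rw [gammaMu_two_mul_add_one hμ, gammaMu_two_mul hμ, gammaMu_two_mul (by linarith)]
  push_cast
  linear_combination 2 * (2 ^ (2 * m) * m ! : ℝ) * hshift

lemma gammaMu_succ_of_odd (hμ : -(1 / 2) < μ) {n : ℕ} (hn : Odd n) :
    gammaMu μ (n + 1) = (n + 1) * gammaMu μ n := by
  obtain ⟨m, rfl⟩ := hn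
  have hshift := gammaMu_succ_of_even hμ (even_two_mul m)
  rw [hshift, show 2 * m + 1 + 1 = 2 * (m + 1) by ring, gammaMu_two_mul hμ, gammaMu_two_mul hμ,
    risingFactorial_succ, Nat.factorial_succ]
  push_cast
  ring

lemma gammaMu_pos (hμ : -(1 / 2) < μ) (n : ℕ) : 0 < gammaMu μ n := by
  induction n with
  | zero => simp [gammaMu_zero hμ]
  | succ n ih =>
    obtain hn | hn := n.even_or_odd
    · rw [gammaMu_succ_of_even hμ hn]
      exact mul_pos (by linarith [n.cast_nonneg (α := ℝ)]) ih
    · rw [gammaMu_succ_of_odd hμ hn]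
      positivity

lemma pow_mul_factorial_le_gammaMu (hμ : -(1 / 2) < μ) (n : ℕ) :
    min 1 (2 * μ + 1) ^ n * n ! ≤ gammaMu μ n := by
  have hr : 0 < min 1 (2 * μ + 1) := lt_min one_pos (by linarith)
  induction n with
  | zero => simp [gammaMu_zero hμ]
  | succ n ih =>
    have hfactor : min 1 (2 * μ + 1) * (n + 1) * gammaMu μ n ≤ gammaMu μ (n + 1) := by
      obtain hn | hn := n.even_or_odd
      · rw [gammaMu_succ_of_even hμ hn]
        refine mul_le_mul_of_nonneg_right ?_ (gammaMu_pos hμ n).le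
        nlinarith [min_le_left 1 (2 * μ + 1), min_le_right 1 (2 * μ + 1), n.cast_nonneg (α := ℝ)]
      · rw [gammaMu_succ_of_odd hμ hn]
        refine mul_le_mul_of_nonneg_right ?_ (gammaMu_pos hμ n).le
        exact mul_le_of_le_one_left (by positivity) (min_le_left _ _)
    calc min 1 (2 * μ + 1) ^ (n + 1) * (n + 1)!
        = min 1 (2 * μ + 1) * (n + 1) * (min 1 (2 * μ + 1) ^ n * n !) := by
          rw [Nat.factorial_succ]
          push_cast
          ring
      _ ≤ min 1 (2 * μ + 1) * (n + 1) * gammaMu μ n := by gcongr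
      _ ≤ gammaMu μ (n + 1) := hfactor

lemma factorial_div_gammaMu_recurrence (hμ : -(1 / 2) < μ) (n : ℕ) :
    (n + 2 * μ + 2) * ((n + 2)! / gammaMu μ (n + 2)) =
      (n + 1)! / gammaMu μ (n + 1) + (n + 1) * (n ! / gammaMu μ n) := by
  have := gammaMu_pos hμ n
  obtain hn | hn := n.even_or_odd
  · have : (0 : ℝ) < n + 1 + 2 * μ := by linarith [n.cast_nonneg (α := ℝ)]
    rw [gammaMu_succ_of_odd hμ hn.add_one, gammaMu_succ_of_even hμ hn, Nat.factorial_succ (n + 1),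
      Nat.factorial_succ n]
    push_cast
    field_simp
    ring
  · have : (0 : ℝ) < n + 1 + 1 + 2 * μ := by linarith [n.cast_nonneg (α := ℝ)]
    rw [gammaMu_succ_of_even hμ hn.add_one, gammaMu_succ_of_odd hμ hn, Nat.factorial_succ (n + 1),
      Nat.factorial_succ n]
    push_cast
    field_simp
    ring

lemma binomialTransform_recurrence_of_ratio {u : ℕ → ℝ}
    (hu : ∀ k, k * u (k + 1) + (2 * μ + 1) * u (k + 1) = -2 * (k * u k + μ * u k)) (n : ℕ) :
    (n + 2 * μ + 2) * binomialTransform u (n + 2) =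
      binomialTransform u (n + 1) + (n + 1) * binomialTransform u n := by
  have h := congrArg (binomialTransform · (n + 1)) (funext hu)
  simp only [binomialTransform_add, binomialTransform_const_mul,
    binomialTransform_natCast_mul_succ] at h
  have hn := binomialTransform_succ u n
  have hn1 := binomialTransform_succ u (n + 1)
  have hn2 := binomialTransform_succ (fun k => u (k + 1)) n
  linear_combination h + (n + 1) * hn + (n + 2 * μ + 2) * hn1 + (n + 1) * hn2

/-- The right-hand side is the terminating series `₂F₁(-n, μ; 2μ + 1; 2)`, which satisfies the same
three-term recurrence as the left-hand side. -/
lemma factorial_div_gammaMu (hμ : -(1 / 2) < μ) (n : ℕ) :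
    n ! / gammaMu μ n = binomialTransform
      (fun k => (-2) ^ k * (risingFactorial μ k / risingFactorial (2 * μ + 1) k)) n := by
  have ha : 0 < 2 * μ + 1 := by linarith
  have hrec := binomialTransform_recurrence_of_ratio (μ := μ)
    (u := fun k => (-2) ^ k * (risingFactorial μ k / risingFactorial (2 * μ + 1) k)) fun k => by
      have := risingFactorial_pos ha k
      have : 0 < 2 * μ + 1 + k := by positivity
      simp only [risingFactorial_succ]
      field_simp
      ring
  induction n using Nat.twoStepInduction with
  | zero => simp [gammaMu_zero hμ, binomialTransform_zero, risingFactorial_zero]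
  | one =>
    have : 1 + 2 * μ ≠ 0 := by linarith
    rw [gammaMu_succ_of_even hμ .zero, gammaMu_zero hμ]
    simp only [binomialTransform_succ, binomialTransform_zero, risingFactorial_succ,
      risingFactorial_zero]
    norm_num
    field_simp
    ring
  | more n ih ih1 =>
    have hn : (n + 2 * μ + 2 : ℝ) ≠ 0 := by linarith [n.cast_nonneg (α := ℝ)]
    refine mul_left_cancel₀ hn ?_
    rw [factorial_div_gammaMu_recurrence hμ, hrec, ih, ih1]

lemma hasSum_expMu (hμ : -(1 / 2) < μ) (z : ℂ) :
    HasSum (fun n => z ^ n / (gammaMu μ n : ℂ)) (expMu μ z) := by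
  have ha : 0 < 2 * μ + 1 := by linarith
  have hconfluent : HasSum (fun k => z ^ k / k ! *
      ((-2) ^ k * (risingFactorial μ k / risingFactorial (2 * μ + 1) k) : ℝ))
      (confluent μ (2 * μ + 1) (-2 * z)) := by
    obtain ⟨i, hi⟩ := exists_nat_ge |μ|
    have hb (k : ℕ) : ‖risingFactorial (μ : ℂ) k‖ ≤ risingFactorial (2 * μ + 1 + i) k :=
      norm_risingFactorial_le (by rw [Complex.norm_real, Real.norm_eq_abs]; linarith) k
    have h := (summable_pow_mul_div_risingFactorial ha hb (-2 * z)).hasSum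
    have htsum : ∑' k : ℕ, (-2 * z) ^ k / k ! *
        (risingFactorial (μ : ℂ) k / risingFactorial ((2 * μ + 1 : ℝ) : ℂ) k) =
          confluent μ (2 * μ + 1) (-2 * z) := by
      simp [confluent, risingFactorial, mul_comm]
    rw [htsum] at h
    refine h.congr_fun fun k => ?_
    push_cast
    rw [mul_pow]
    ring
  refine (hasSum_exp_mul_binomialTransform hconfluent).congr_fun fun n => ?_
  have hcoeff := congrArg (Complex.ofReal) (factorial_div_gammaMu hμ n)
  have := n.factorial_ne_zero
  simp only [binomialTransform] at hcoeff ⊢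
  push_cast at hcoeff ⊢
  rw [← hcoeff]
  field_simp

end GeneralizedExponential

/-- The factor normalizing `exp (-x ^ 2 / 2) * Φ(-m, c, x ^ 2)`, with respect to the weight
`|x| ^ (2 * c - 1)`; the sign is that of `H_{2m}`. -/
def hermiteCoeff (c : ℝ) (m : ℕ) : ℝ :=
  (-1) ^ m * √(risingFactorial c m / (m ! * Real.Gamma c))

section Hermite

lemma confluentPoly_eq_kummerPoly {c : ℝ} (hc : 0 < c) (x : ℝ) (m : ℕ) :
    confluentPoly m c x = kummerPoly c x m := by
  refine Finset.sum_congr rfl fun k _ => ?_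
  beta_reduce
  rw [add_comm, Gamma_add_natCast hc, div_mul_cancel_left₀ (Real.Gamma_pos_of_pos hc).ne',
    neg_pow x]
  ring

lemma hermiteCoeff_mul_self {c : ℝ} (hc : 0 < c) (m : ℕ) :
    hermiteCoeff c m * hermiteCoeff c m = risingFactorial c m / (m ! * Real.Gamma c) := by
  have := risingFactorial_pos hc m
  have := Real.Gamma_pos_of_pos hc
  rw [hermiteCoeff, mul_mul_mul_comm, Real.mul_self_sqrt (by positivity), ← mul_pow]
  simp

lemma hermiteCoeff_ne_zero {c : ℝ} (hc : 0 < c) (m : ℕ) : hermiteCoeff c m ≠ 0 := by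
  have := risingFactorial_pos hc m
  have := Real.Gamma_pos_of_pos hc
  exact mul_ne_zero (by simp) (by positivity)

lemma sqrt_sq_mul {a : ℝ} (ha : 0 ≤ a) (b : ℝ) : √(a ^ 2 * b) = a * √b := by
  rw [Real.sqrt_mul (by positivity), Real.sqrt_sq ha]

variable {μ : ℝ}

lemma hermiteFun_two_mul (hμ : -(1 / 2) < μ) (m : ℕ) (x : ℝ) :
    hermiteFun μ (2 * m) x = hermiteCoeff (μ + 1 / 2) m *
      (Real.exp (-(1 / 2) * x ^ 2) * kummerPoly (μ + 1 / 2) (x ^ 2) m) := by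
  have hc : 0 < μ + 1 / 2 := by linarith
  have hsqrt : √(gammaMu μ (2 * m) / Real.Gamma (μ + 1 / 2)) =
      2 ^ m * m ! * √(risingFactorial (μ + 1 / 2) m / (m ! * Real.Gamma (μ + 1 / 2))) := by
    rw [← sqrt_sq_mul (by positivity), gammaMu_two_mul hμ, pow_mul']
    congr 1
    field_simp
  have hexponent : ((2 * m : ℕ) : ℝ) / 2 = m := by push_cast; ring
  have := (2 * m).factorial_ne_zero
  rw [hermiteFun, hermiteH, if_pos (even_two_mul m), Nat.mul_div_cancel_left m two_pos,
    confluentPoly_eq_kummerPoly hc, ← Real.sqrt_eq_rpow, hsqrt, hexponent, Real.rpow_natCast,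
    hermiteCoeff]
  field_simp

lemma Gamma_add_one_add_half (hμ : -(1 / 2) < μ) :
    Real.Gamma (μ + 1 + 1 / 2) = (μ + 1 / 2) * Real.Gamma (μ + 1 / 2) := by
  rw [add_right_comm, Real.Gamma_add_one (by linarith)]

lemma hermiteFun_two_mul_add_one (hμ : -(1 / 2) < μ) (m : ℕ) (x : ℝ) :
    hermiteFun μ (2 * m + 1) x = x * hermiteFun (μ + 1) (2 * m) x := by
  have hc : 0 < μ + 1 / 2 := by linarith
  have hsqrt : √(gammaMu μ (2 * m + 1) / Real.Gamma (μ + 1 / 2)) =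
      √2 * ((μ + 1 / 2) * √(gammaMu (μ + 1) (2 * m) / Real.Gamma (μ + 1 + 1 / 2))) := by
    have := Real.Gamma_pos_of_pos hc
    rw [← sqrt_sq_mul hc.le, ← Real.sqrt_mul zero_le_two, gammaMu_two_mul_add_one hμ,
      Gamma_add_one_add_half hμ]
    congr 1
    generalize Real.Gamma (μ + 1 / 2) = Γ at *
    field_simp
  have hdiv : (2 * m + 1) / 2 = m := by lia
  have hexponent : ((2 * m + 1 : ℕ) : ℝ) / 2 = ((2 * m : ℕ) : ℝ) / 2 + 1 / 2 := by push_cast; ring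
  have := (2 * m).factorial_ne_zero
  have := (2 * m + 1).factorial_ne_zero
  rw [hermiteFun, hermiteFun, hermiteH, hermiteH, if_pos (even_two_mul m),
    if_neg (Nat.not_even_two_mul_add_one m), hdiv, Nat.mul_div_cancel_left m two_pos,
    ← Real.sqrt_eq_rpow, ← Real.sqrt_eq_rpow, hsqrt, hexponent, Real.rpow_add two_pos,
    ← Real.sqrt_eq_rpow, show μ + 3 / 2 = μ + 1 + 1 / 2 by ring]
  generalize confluentPoly m (μ + 1 + 1 / 2) (x ^ 2) = P
  generalize √(gammaMu (μ + 1) (2 * m) / Real.Gamma (μ + 1 + 1 / 2)) = S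
  generalize μ + 1 / 2 = c at hc
  field_simp

lemma expMu_eq_besselSeries (hμ : -(1 / 2) < μ) (z : ℂ) :
    expMu μ z = besselSeries (μ + 1 / 2 : ℝ) (z ^ 2 / 4) +
      z / (2 * μ + 1 : ℝ) * besselSeries (μ + 1 + 1 / 2 : ℝ) (z ^ 2 / 4) := by
  have heven (k : ℕ) : z ^ (2 * k) / (gammaMu μ (2 * k) : ℂ) =
      (z ^ 2 / 4) ^ k / (k ! * risingFactorial ((μ + 1 / 2 : ℝ) : ℂ) k) := by
    rw [gammaMu_two_mul hμ, div_pow, ← pow_mul, div_div, ← mul_assoc]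
    push_cast
    rw [pow_mul 2]
    norm_num
  have hodd (k : ℕ) : z ^ (2 * k + 1) / (gammaMu μ (2 * k + 1) : ℂ) = z / (2 * μ + 1 : ℝ) *
      ((z ^ 2 / 4) ^ k / (k ! * risingFactorial ((μ + 1 + 1 / 2 : ℝ) : ℂ) k)) := by
    rw [gammaMu_two_mul_add_one hμ, gammaMu_two_mul (by linarith), div_pow, ← pow_mul]
    push_cast
    rw [pow_mul 2, div_div, div_mul_div_comm]
    norm_num
    ring
  refine (hasSum_expMu hμ z).unique (HasSum.even_add_odd ?_ ?_)
  · exact (hasSum_besselSeries (by linarith) _).congr_fun heven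
  · exact ((hasSum_besselSeries (by linarith) _).mul_left _).congr_fun hodd

lemma hasSum_hermiteFun_two_mul (hμ : -(1 / 2) < μ) (x y : ℝ) {w : ℂ} (hw : ‖w‖ < 1) :
    HasSum (fun m => (hermiteFun μ (2 * m) x : ℂ) * hermiteFun μ (2 * m) y * w ^ m)
      (1 / Real.Gamma (μ + 1 / 2) * (1 / (1 - w) ^ (μ + 1 / 2 : ℂ)) *
        Complex.exp (-(1 / 2) * ((x : ℂ) ^ 2 + (y : ℂ) ^ 2) * ((1 + w) / (1 - w))) *
        besselSeries (μ + 1 / 2 : ℝ) ((x : ℂ) ^ 2 * (y : ℂ) ^ 2 * w / (1 - w) ^ 2)) := by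
  have hc : 0 < μ + 1 / 2 := by linarith
  have hw1 := one_sub_ne_zero_of_norm_lt_one hw
  have hexp : Complex.exp (-(1 / 2) * ((x : ℂ) ^ 2 + (y : ℂ) ^ 2) * ((1 + w) / (1 - w))) =
      Complex.exp (-(1 / 2) * x ^ 2) * Complex.exp (-(1 / 2) * y ^ 2) *
        Complex.exp (-((x ^ 2 + y ^ 2) * (w / (1 - w)))) := by
    rw [← Complex.exp_add, ← Complex.exp_add]
    congr 1
    field_simp
    ring
  have hterm (m : ℕ) : (hermiteFun μ (2 * m) x : ℂ) * hermiteFun μ (2 * m) y * w ^ m =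
      1 / Real.Gamma (μ + 1 / 2) *
        (Complex.exp (-(1 / 2) * x ^ 2) * Complex.exp (-(1 / 2) * y ^ 2)) *
        (risingFactorial ((μ + 1 / 2 : ℝ) : ℂ) m / m ! * w ^ m *
          (kummerPoly ((μ + 1 / 2 : ℝ) : ℂ) (x ^ 2) m *
            kummerPoly ((μ + 1 / 2 : ℝ) : ℂ) (y ^ 2) m)) := by
    have hsq := congrArg Complex.ofReal (hermiteCoeff_mul_self hc m)
    rw [hermiteFun_two_mul hμ, hermiteFun_two_mul hμ]
    push_cast at hsq ⊢
    rw [mul_mul_mul_comm, hsq]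
    ring
  have h := (hille_hardy hc (x ^ 2) (y ^ 2) hw).mul_left
    (1 / Real.Gamma (μ + 1 / 2) * (Complex.exp (-(1 / 2) * x ^ 2) * Complex.exp (-(1 / 2) * y ^ 2)))
  rw [hexp]
  refine (congrArg (HasSum _) ?_).mp (h.congr_fun hterm)
  push_cast
  ring

lemma hasSum_hermiteFun_mul (hμ : -(1 / 2) < μ) (x y : ℝ) {z : ℂ} (hz : ‖z‖ < 1) :
    HasSum (fun n => (hermiteFun μ n x : ℂ) * hermiteFun μ n y * z ^ n)
      (1 / Real.Gamma (μ + 1 / 2) * (1 / (1 - z ^ 2) ^ (μ + 1 / 2 : ℂ)) *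
        Complex.exp (-(1 / 2) * ((x : ℂ) ^ 2 + (y : ℂ) ^ 2) * ((1 + z ^ 2) / (1 - z ^ 2))) *
        expMu μ (2 * x * y * (z / (1 - z ^ 2)))) := by
  have hz2 : ‖z ^ 2‖ < 1 := by simpa using pow_lt_one₀ (norm_nonneg z) hz two_ne_zero
  have hw1 := one_sub_ne_zero_of_norm_lt_one hz2
  have heven := hasSum_hermiteFun_two_mul hμ x y hz2
  have hodd := (hasSum_hermiteFun_two_mul (μ := μ + 1) (by linarith) x y hz2).mul_left (x * y * z)
  have hsum := HasSum.even_add_odd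
    (f := fun n => (hermiteFun μ n x : ℂ) * hermiteFun μ n y * z ^ n)
    (heven.congr_fun fun m => by rw [pow_mul])
    (hodd.congr_fun fun m => by
      rw [hermiteFun_two_mul_add_one hμ, hermiteFun_two_mul_add_one hμ, pow_succ, pow_mul]
      push_cast
      ring)
  refine (congrArg (HasSum _) ?_).mp hsum
  have hpow : (1 - z ^ 2) ^ (((μ + 1 : ℝ) : ℂ) + 1 / 2) =
      (1 - z ^ 2) ^ (μ + 1 / 2 : ℂ) * (1 - z ^ 2) := by
    rw [Complex.ofReal_add, Complex.ofReal_one, add_right_comm, Complex.cpow_add _ _ hw1,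
      Complex.cpow_one]
  have harg : (2 * x * y * (z / (1 - z ^ 2))) ^ 2 / 4 =
      (x : ℂ) ^ 2 * (y : ℂ) ^ 2 * z ^ 2 / (1 - z ^ 2) ^ 2 := by
    field_simp
    ring
  rw [expMu_eq_besselSeries hμ, harg, Gamma_add_one_add_half hμ, hpow, mul_add]
  push_cast
  rw [show (μ + 1 / 2 : ℂ) = (2 * μ + 1) / 2 by ring]
  simp only [div_eq_mul_inv, mul_inv, inv_inv]
  ring

end Hermite

section WeightedIntegrals

instance (μ : ℝ) : SigmaFinite (weightMeasure μ) :=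
  SigmaFinite.withDensity_of_ne_top (.of_forall fun _ => ENNReal.ofReal_ne_top)

variable {E : Type*} [NormedAddCommGroup E] [NormedSpace ℝ E]

lemma integrable_weightMeasure_iff (μ : ℝ) {g : ℝ → E} :
    Integrable g (weightMeasure μ) ↔ Integrable fun t => |t| ^ (2 * μ) • g t := by
  rw [weightMeasure, integrable_withDensity_iff_integrable_smul' (by fun_prop)
    (.of_forall fun _ => ENNReal.ofReal_lt_top)]
  simp only [ENNReal.toReal_ofReal (Real.rpow_nonneg (abs_nonneg _) _)]

lemma integral_weightMeasure (μ : ℝ) (g : ℝ → E) :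
    ∫ t, g t ∂weightMeasure μ = ∫ t, |t| ^ (2 * μ) • g t := by
  rw [weightMeasure, integral_withDensity_eq_integral_toReal_smul (by fun_prop)
    (.of_forall fun _ => ENNReal.ofReal_lt_top)]
  simp only [ENNReal.toReal_ofReal (Real.rpow_nonneg (abs_nonneg _) _)]

lemma integral_weightMeasure_eq_zero_of_odd (μ : ℝ) {g : ℝ → E} (hg : ∀ t, g (-t) = -g t) :
    ∫ t, g t ∂weightMeasure μ = 0 := by
  have h := integral_neg_eq_self (fun t => |t| ^ (2 * μ) • g t) volume
  simp only [hg, abs_neg, smul_neg, integral_neg] at h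
  rw [integral_weightMeasure]
  have : IsAddTorsionFree E := .of_isTorsionFree ℝ E
  exact self_eq_neg.1 h.symm

lemma weightMeasure_add_one (μ : ℝ) :
    weightMeasure (μ + 1) = (weightMeasure μ).withDensity fun t => ENNReal.ofReal (t ^ 2) := by
  rw [weightMeasure, weightMeasure, ← withDensity_mul _ (by fun_prop) (by fun_prop)]
  refine withDensity_congr_ae ?_
  filter_upwards [Measure.ae_ne volume 0] with t ht
  rw [Pi.mul_apply, ← ENNReal.ofReal_mul (by positivity), mul_add, mul_one,
    Real.rpow_add (abs_pos.2 ht), Real.rpow_two, sq_abs]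

lemma integral_sq_smul_weightMeasure (μ : ℝ) (g : ℝ → E) :
    ∫ t, t ^ 2 • g t ∂weightMeasure μ = ∫ t, g t ∂weightMeasure (μ + 1) := by
  rw [weightMeasure_add_one, integral_withDensity_eq_integral_toReal_smul (by fun_prop)
    (.of_forall fun _ => ENNReal.ofReal_lt_top)]
  simp only [ENNReal.toReal_ofReal (sq_nonneg _)]

lemma integrable_binomialTransform {α : Type*} {_ : MeasurableSpace α} {ν : Measure α}
    {g : ℕ → α → ℝ} (hg : ∀ k, Integrable (g k) ν) (m : ℕ) :
    Integrable (fun t => binomialTransform (fun k => g k t) m) ν :=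
  integrable_finsetSum _ fun k _ => (hg k).const_mul _

lemma integral_binomialTransform {α : Type*} {_ : MeasurableSpace α} {ν : Measure α}
    {g : ℕ → α → ℝ} (hg : ∀ k, Integrable (g k) ν) (m : ℕ) :
    ∫ t, binomialTransform (fun k => g k t) m ∂ν =
      binomialTransform (fun k => ∫ t, g k t ∂ν) m := by
  simp only [binomialTransform]
  rw [integral_finsetSum _ fun k _ => (hg k).const_mul _]
  simp only [integral_const_mul]

variable {μ s : ℝ}

lemma integral_gaussian_weightMeasure (hμ : -(1 / 2) < μ) (hs : 0 < s) :
    ∫ t, Real.exp (-s * t ^ 2) ∂weightMeasure μ =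
      s ^ (-(μ + 1 / 2)) * Real.Gamma (μ + 1 / 2) := by
  have hhalf := integral_rpow_mul_exp_neg_mul_rpow (p := 2) (q := 2 * μ) two_pos (by linarith) hs
  have habs := integral_comp_abs (f := fun u => u ^ (2 * μ) * Real.exp (-s * u ^ 2))
  simp only [Real.rpow_two, neg_div] at hhalf
  simp only [sq_abs] at habs
  simp only [integral_weightMeasure, smul_eq_mul]
  rw [habs, hhalf, show (2 * μ + 1) / 2 = μ + 1 / 2 by ring]
  ring

lemma integral_sq_pow_mul_gaussian (hμ : -(1 / 2) < μ) (hs : 0 < s) (q : ℕ) :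
    ∫ t, (t ^ 2) ^ q * Real.exp (-s * t ^ 2) ∂weightMeasure μ =
      s ^ (-(μ + 1 / 2)) * Real.Gamma (μ + 1 / 2) *
        ((s⁻¹) ^ q * risingFactorial (μ + 1 / 2) q) := by
  induction q generalizing μ with
  | zero => simp only [pow_zero, one_mul, mul_one, risingFactorial_zero,
      integral_gaussian_weightMeasure hμ hs]
  | succ q ih =>
    have hpow : s ^ (-(μ + 1 + 1 / 2)) = s ^ (-(μ + 1 / 2)) * s⁻¹ := by
      rw [← Real.rpow_neg_one s, ← Real.rpow_add hs]
      congr 1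
      ring
    have hshift := integral_sq_smul_weightMeasure μ fun t => (t ^ 2) ^ q * Real.exp (-s * t ^ 2)
    simp only [smul_eq_mul, ← mul_assoc, ← pow_succ'] at hshift
    rw [hshift, ih (by linarith), Gamma_add_one_add_half hμ, hpow, risingFactorial_succ_left,
      add_right_comm]
    ring

lemma integrable_sq_pow_mul_gaussian (hμ : -(1 / 2) < μ) (hs : 0 < s) (q : ℕ) :
    Integrable (fun t => (t ^ 2) ^ q * Real.exp (-s * t ^ 2)) (weightMeasure μ) := by
  have hc : 0 < μ + 1 / 2 := by linarith
  have := risingFactorial_pos hc q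
  have := Real.Gamma_pos_of_pos hc
  refine .of_integral_ne_zero ?_
  rw [integral_sq_pow_mul_gaussian hμ hs]
  positivity

lemma sq_pow_mul_kummerPoly_mul_gaussian (c s t : ℝ) (m q : ℕ) :
    (t ^ 2) ^ q * (kummerPoly c (t ^ 2) m * Real.exp (-s * t ^ 2)) =
      binomialTransform (fun i =>
        (-1) ^ i / risingFactorial c i * ((t ^ 2) ^ (q + i) * Real.exp (-s * t ^ 2))) m := by
  rw [kummerPoly, mul_comm (binomialTransform _ _), ← mul_assoc, ← binomialTransform_const_mul]
  refine binomialTransform_congr fun i _ => ?_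
  rw [neg_pow (t ^ 2)]
  ring

lemma integrable_sq_pow_mul_kummerPoly_mul_gaussian (hμ : -(1 / 2) < μ) (hs : 0 < s)
    (c : ℝ) (m q : ℕ) :
    Integrable (fun t => (t ^ 2) ^ q * (kummerPoly c (t ^ 2) m * Real.exp (-s * t ^ 2)))
      (weightMeasure μ) := by
  simp only [sq_pow_mul_kummerPoly_mul_gaussian]
  exact integrable_binomialTransform
    (fun i => (integrable_sq_pow_mul_gaussian hμ hs (q + i)).const_mul _) m

lemma integral_sq_pow_mul_kummerPoly_mul_gaussian (hμ : -(1 / 2) < μ) (hs : 0 < s) (m q : ℕ) :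
    ∫ t, (t ^ 2) ^ q * (kummerPoly (μ + 1 / 2) (t ^ 2) m * Real.exp (-s * t ^ 2))
        ∂weightMeasure μ =
      s ^ (-(μ + 1 / 2)) * Real.Gamma (μ + 1 / 2) *
        ((s⁻¹) ^ q * risingFactorial (μ + 1 / 2) q) *
        binomialTransform (fun l => (-s⁻¹) ^ l * (1 - s⁻¹) ^ (m - l) *
          (q.descFactorial l / risingFactorial (μ + 1 / 2) l)) m := by
  have hc : 0 < μ + 1 / 2 := by linarith
  simp only [sq_pow_mul_kummerPoly_mul_gaussian, sub_eq_add_neg,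
    ← binomialTransform_pow_mul_binomialTransform]
  rw [integral_binomialTransform
    fun i => (integrable_sq_pow_mul_gaussian hμ hs (q + i)).const_mul _,
    ← binomialTransform_const_mul]
  refine binomialTransform_congr fun i _ => ?_
  rw [integral_const_mul, integral_sq_pow_mul_gaussian hμ hs, risingFactorial_add,
    ← chu_vandermonde fun k => (risingFactorial_pos hc k).ne', neg_pow s⁻¹]
  ring

lemma binomialTransform_neg_one_pow_mul_descFactorial (m n : ℕ) :
    binomialTransform (fun q => (-1) ^ q * (q.descFactorial m : ℝ)) n =
      if m = n then (-1) ^ m * (m ! : ℝ) else 0 := by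
  have hdelta (q : ℕ) : (q.descFactorial m : ℝ) =
      binomialTransform (fun k => if k = m then (m ! : ℝ) else 0) q := by
    rw [binomialTransform_eq_sum_range _ (le_max_left q m),
      Nat.descFactorial_eq_factorial_mul_choose, mul_comm]
    simp
  simp only [hdelta]
  rw [binomialTransform_binomialTransform_neg_one]
  obtain rfl | hmn := eq_or_ne m n
  · simp
  · simp [hmn, hmn.symm]

lemma integral_sq_pow_mul_kummerPoly_mul_exp_neg_sq (hμ : -(1 / 2) < μ) (m q : ℕ) :
    ∫ t, (t ^ 2) ^ q * (kummerPoly (μ + 1 / 2) (t ^ 2) m * Real.exp (-1 * t ^ 2))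
        ∂weightMeasure μ =
      Real.Gamma (μ + 1 / 2) * risingFactorial (μ + 1 / 2) q *
        ((-1) ^ m * (q.descFactorial m / risingFactorial (μ + 1 / 2) m)) := by
  rw [integral_sq_pow_mul_kummerPoly_mul_gaussian hμ one_pos, binomialTransform,
    Finset.sum_eq_single_of_mem m (Finset.self_mem_range_succ m) fun l hl hlm => ?_]
  · simp
  · have : m - l ≠ 0 := by have := Finset.mem_range_succ_iff.1 hl; lia
    simp [this]

lemma integral_kummerPoly_mul_kummerPoly (hμ : -(1 / 2) < μ) (m n : ℕ) :
    ∫ t, kummerPoly (μ + 1 / 2) (t ^ 2) n * (kummerPoly (μ + 1 / 2) (t ^ 2) m *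
        Real.exp (-1 * t ^ 2)) ∂weightMeasure μ =
      if m = n then Real.Gamma (μ + 1 / 2) * (m ! / risingFactorial (μ + 1 / 2) m) else 0 := by
  have hc : 0 < μ + 1 / 2 := by linarith
  have hexpand (t : ℝ) : kummerPoly (μ + 1 / 2) (t ^ 2) n *
      (kummerPoly (μ + 1 / 2) (t ^ 2) m * Real.exp (-1 * t ^ 2)) =
        binomialTransform (fun q => (-1) ^ q / risingFactorial (μ + 1 / 2) q *
          ((t ^ 2) ^ q * (kummerPoly (μ + 1 / 2) (t ^ 2) m * Real.exp (-1 * t ^ 2)))) n := by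
    rw [kummerPoly, mul_comm, ← binomialTransform_const_mul]
    refine binomialTransform_congr fun q _ => ?_
    rw [neg_pow (t ^ 2)]
    ring
  have hterm (q : ℕ) : (-1) ^ q / risingFactorial (μ + 1 / 2) q *
      (Real.Gamma (μ + 1 / 2) * risingFactorial (μ + 1 / 2) q *
        ((-1) ^ m * (q.descFactorial m / risingFactorial (μ + 1 / 2) m))) =
      (-1) ^ m * (Real.Gamma (μ + 1 / 2) / risingFactorial (μ + 1 / 2) m) *
        ((-1) ^ q * q.descFactorial m) := by
    have := (risingFactorial_pos hc q).ne'
    generalize Real.Gamma (μ + 1 / 2) = Γ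
    generalize μ + 1 / 2 = c at *
    field_simp
  simp only [hexpand]
  rw [integral_binomialTransform
    fun q => (integrable_sq_pow_mul_kummerPoly_mul_gaussian hμ one_pos _ m q).const_mul _]
  simp only [integral_const_mul, integral_sq_pow_mul_kummerPoly_mul_exp_neg_sq hμ, hterm,
    binomialTransform_const_mul, binomialTransform_neg_one_pow_mul_descFactorial]
  split_ifs
  · have hsign : (-1 : ℝ) ^ m * (-1) ^ m = 1 := by simp [← mul_pow]
    linear_combination Real.Gamma (μ + 1 / 2) * (m ! / risingFactorial (μ + 1 / 2) m) * hsign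
  · simp

end WeightedIntegrals

section ExponentialType

lemma integrable_and_hasSum_integral_of_exponentialType {ν : Measure ℝ} {a : ℕ → ℂ} {E : ℂ → ℂ}
    {r : ℝ} (ha : ∀ n, ‖a n‖ ≤ r ^ n / n !) (hE : ∀ z, HasSum (fun n => a n * z ^ n) (E z))
    {f : ℝ → ℂ} (hf : ∀ b, Integrable (fun t => (Real.exp (b * |t|) : ℂ) * f t) ν) (z : ℂ) :
    Integrable (fun t : ℝ => E (z * t) * f t) ν ∧
      HasSum (fun n => a n * z ^ n * ∫ t : ℝ, (t : ℂ) ^ n * f t ∂ν)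
        (∫ t : ℝ, E (z * t) * f t ∂ν) := by
  have hfint : Integrable f ν := by simpa using hf 0
  have hterm (n : ℕ) :
      AEStronglyMeasurable (fun t : ℝ => a n * (z * t) ^ n * f t) ν :=
    .mul (by fun_prop) hfint.1
  have hsum (t : ℝ) : HasSum (fun n => a n * (z * t) ^ n * f t) (E (z * t) * f t) :=
    (hE _).mul_right _
  have hmajorant (t : ℝ) :
      HasSum (fun n => (r * ‖z‖ * |t|) ^ n / n ! * ‖f t‖) (Real.exp (r * ‖z‖ * |t|) * ‖f t‖) := by
    have hexp := NormedSpace.expSeries_div_hasSum_exp (r * ‖z‖ * |t|)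
    rw [← Real.exp_eq_exp_ℝ] at hexp
    exact hexp.mul_right _
  have hbound (n : ℕ) (t : ℝ) :
      ‖a n * (z * t) ^ n * f t‖ ≤ (r * ‖z‖ * |t|) ^ n / n ! * ‖f t‖ := by
    calc ‖a n * (z * t) ^ n * f t‖ = ‖a n‖ * (‖z‖ * |t|) ^ n * ‖f t‖ := by simp
      _ ≤ r ^ n / n ! * (‖z‖ * |t|) ^ n * ‖f t‖ := by gcongr; exact ha n
      _ = (r * ‖z‖ * |t|) ^ n / n ! * ‖f t‖ := by rw [mul_assoc r, mul_pow r]; ring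
  have hdom : Integrable (fun t => Real.exp (r * ‖z‖ * |t|) * ‖f t‖) ν := by
    simpa only [norm_mul, Complex.norm_real, Real.norm_eq_abs, Real.abs_exp] using
      (hf (r * ‖z‖)).norm
  constructor
  · refine hdom.mono' (aestronglyMeasurable_of_tendsto_ae Filter.atTop
      (fun N => Finset.aestronglyMeasurable_fun_sum (range N) fun n _ => hterm n)
      (.of_forall fun t => (hsum t).tendsto_sum_nat)) (.of_forall fun t => ?_)
    exact (hsum t).norm_le_of_bounded (hmajorant t) (hbound · t)
  · refine (hasSum_integral_of_dominated_convergence _ hterm (fun n => .of_forall (hbound n))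
      (.of_forall fun t => (hmajorant t).summable) ?_ (.of_forall hsum)).congr_fun fun n => ?_
    · simpa only [(hmajorant _).tsum_eq] using hdom
    · rw [← integral_const_mul]
      exact integral_congr_ae (.of_forall fun t => by simp only [mul_pow]; ring)

open scoped FourierTransform SchwartzMap ContDiff in
lemma ae_eq_zero_of_fourierIntegral_eq_zero {V : Type*} [NormedAddCommGroup V]
    [InnerProductSpace ℝ V] [FiniteDimensional ℝ V] [MeasurableSpace V] [BorelSpace V]
    {ν : Measure V} [SigmaFinite ν] {h : V → ℂ} (hh : Integrable h ν)
    (hzero : ∀ ξ, VectorFourier.fourierIntegral 𝐞 ν (innerₗ V) h ξ = 0) : h =ᵐ[ν] 0 := by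
  refine ae_eq_zero_of_integral_contDiff_smul_eq_zero hh.locallyIntegrable fun g hg hgc => ?_
  have hsupp : HasCompactSupport (Complex.ofRealCLM ∘ g) := hgc.comp_left rfl
  have hsmooth : ContDiff ℝ ∞ (Complex.ofRealCLM ∘ g) := by fun_prop
  let G : 𝓢(V, ℂ) := hsupp.toSchwartzMap hsmooth
  have hduality := VectorFourier.integral_fourierIntegral_smul_eq_flip (L := innerₗ V) (μ := ν)
    (ν := volume) (f := h) (g := (𝓕⁻ G : 𝓢(V, ℂ)))
    Real.continuous_fourierChar continuous_inner hh (𝓕⁻ G : 𝓢(V, ℂ)).integrable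
  have hinversion : VectorFourier.fourierIntegral 𝐞 volume (innerₗ V).flip (𝓕⁻ G : 𝓢(V, ℂ)) =
      fun x => (g x : ℂ) := by
    have hG : 𝓕 (𝓕⁻ G : 𝓢(V, ℂ)) = G := FourierTransform.fourier_fourierInv_eq G
    have hcoe := congrArg (fun F : 𝓢(V, ℂ) => (F : V → ℂ)) hG
    simp only [SchwartzMap.fourier_coe] at hcoe
    rwa [flip_innerₗ]
  simp only [hzero, hinversion, zero_smul, integral_zero] at hduality
  simpa [mul_comm] using hduality.symm

lemma ae_eq_zero_of_moments_eq_zero {ν : Measure ℝ} [SigmaFinite ν] {h : ℝ → ℂ}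
    (hexp : ∀ b, Integrable (fun t => (Real.exp (b * |t|) : ℂ) * h t) ν)
    (hmoments : ∀ n, ∫ t : ℝ, (t : ℂ) ^ n * h t ∂ν = 0) : h =ᵐ[ν] 0 := by
  have hh : Integrable h ν := by simpa using hexp 0
  refine ae_eq_zero_of_fourierIntegral_eq_zero hh fun ξ => ?_
  have hseries (z : ℂ) : HasSum (fun n => (1 / n ! : ℂ) * z ^ n) (Complex.exp z) := by
    rw [Complex.exp_eq_exp_ℂ]
    exact (NormedSpace.expSeries_div_hasSum_exp z).congr_fun fun n => by ring
  have hsum := (integrable_and_hasSum_integral_of_exponentialType (r := 1) (fun n => by simp)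
    hseries hexp (-(2 * Real.pi * ξ * Complex.I))).2
  simp only [hmoments, mul_zero] at hsum
  rw [VectorFourier.fourierIntegral, hasSum_zero.unique hsum]
  refine integral_congr_ae (.of_forall fun t => ?_)
  simp only [Circle.smul_def, Real.fourierChar_apply, innerₗ_apply_apply, smul_eq_mul]
  congr 2
  simp
  ring

variable {μ : ℝ}

lemma memLp_exp_mul_gaussian (hμ : -(1 / 2) < μ) {s : ℝ} (hs : 0 < s) {p : ENNReal} (hp : p ≠ 0)
    (hp' : p ≠ ⊤) (a : ℝ) :
    MemLp (fun t => Real.exp (a * |t|) * Real.exp (-s * t ^ 2)) p (weightMeasure μ) := by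
  have hr := ENNReal.toReal_pos hp hp'
  set r := p.toReal
  have hgaussian : Integrable (fun t => Real.exp (-(r * s / 2) * t ^ 2)) (weightMeasure μ) := by
    simpa using integrable_sq_pow_mul_gaussian hμ (by positivity) 0
  rw [← integrable_norm_rpow_iff (by fun_prop) hp hp']
  refine (hgaussian.const_mul (Real.exp (r * a ^ 2 / (2 * s)))).mono'
    (Measurable.aestronglyMeasurable (by fun_prop)) (.of_forall fun t => ?_)
  rw [← Real.exp_add, ← Real.exp_add, Real.norm_of_nonneg (Real.exp_pos _).le, ← Real.exp_mul,
    Real.norm_of_nonneg (Real.exp_pos _).le, Real.exp_le_exp, ← sub_nonneg]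
  have hsquare : r * a ^ 2 / (2 * s) + -(r * s / 2) * t ^ 2 - (a * |t| + -s * t ^ 2) * r =
      r * (a - s * |t|) ^ 2 / (2 * s) := by
    rw [← sq_abs t]
    field_simp
    ring
  rw [hsquare]
  positivity

lemma memLp_exp_mul_of_mem_fourierDomain (hμ : -(1 / 2) < μ) {p : ENNReal} (hp : p ≠ 0)
    (hp' : p ≠ ⊤) {f : ℝ → ℂ} (hf : f ∈ fourierDomain) (a : ℝ) :
    MemLp (fun t => (Real.exp (a * |t|) : ℂ) * f t) p (weightMeasure μ) := by
  induction hf using Submodule.span_induction with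
  | mem f hf =>
    obtain ⟨n, rfl⟩ := hf
    refine ((memLp_exp_mul_gaussian hμ one_half_pos hp hp' (a + 1)).const_mul (n ! : ℝ)).of_le
      (by fun_prop) (.of_forall fun t => ?_)
    have hpow : |t| ^ n ≤ n ! * Real.exp |t| := by
      have := Real.pow_div_factorial_le_exp |t| (abs_nonneg t) n
      rwa [div_le_iff₀' (by positivity)] at this
    rw [← Complex.ofReal_mul, Complex.norm_real]
    simp only [norm_mul, norm_pow, Real.norm_eq_abs, Real.abs_exp, Nat.abs_cast, add_mul, one_mul,
      Real.exp_add]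
    nlinarith [mul_le_mul_of_nonneg_left hpow
      (mul_pos (Real.exp_pos (a * |t|)) (Real.exp_pos (-(1 / 2) * t ^ 2))).le]
  | zero => simp
  | add f g _ _ hf hg => exact (hf.add hg).ae_eq (.of_forall fun t => (mul_add _ _ _).symm)
  | smul c f _ hf => simpa only [Pi.smul_apply, smul_eq_mul, mul_left_comm] using hf.const_mul c

end ExponentialType

section Orthonormality

variable {μ : ℝ}

lemma hermiteFun_neg (μ : ℝ) (n : ℕ) (x : ℝ) :
    hermiteFun μ n (-x) = (-1) ^ n * hermiteFun μ n x := by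
  obtain hn | hn := n.even_or_odd
  · simp [hermiteFun, hermiteH, hn]
  · simp only [hermiteFun, hermiteH, Nat.not_even_iff_odd.2 hn, if_false, hn.neg_one_pow, neg_sq]
    ring

lemma integral_pow_mul_hermiteFun_of_odd (μ : ℝ) {k n : ℕ} (hkn : Odd (k + n)) :
    ∫ t : ℝ, (t : ℂ) ^ k * (hermiteFun μ n t : ℂ) ∂weightMeasure μ = 0 := by
  refine integral_weightMeasure_eq_zero_of_odd μ fun t => ?_
  have hsign : (-1 : ℂ) ^ k * (-1) ^ n = -1 := by rw [← pow_add, hkn.neg_one_pow]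
  rw [hermiteFun_neg, Complex.ofReal_neg, neg_pow]
  push_cast
  linear_combination (t : ℂ) ^ k * hermiteFun μ n t * hsign

lemma integral_hermiteFun_two_mul_mul_hermiteFun_two_mul (hμ : -(1 / 2) < μ) (m n : ℕ) :
    ∫ t, hermiteFun μ (2 * m) t * hermiteFun μ (2 * n) t ∂weightMeasure μ =
      if m = n then 1 else 0 := by
  have hc : 0 < μ + 1 / 2 := by linarith
  have hprod (t : ℝ) : hermiteFun μ (2 * m) t * hermiteFun μ (2 * n) t =
      hermiteCoeff (μ + 1 / 2) m * hermiteCoeff (μ + 1 / 2) n *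
        (kummerPoly (μ + 1 / 2) (t ^ 2) n *
          (kummerPoly (μ + 1 / 2) (t ^ 2) m * Real.exp (-1 * t ^ 2))) := by
    rw [hermiteFun_two_mul hμ, hermiteFun_two_mul hμ,
      show -1 * t ^ 2 = -(1 / 2) * t ^ 2 + -(1 / 2) * t ^ 2 by ring, Real.exp_add]
    ring
  simp only [hprod]
  rw [integral_const_mul, integral_kummerPoly_mul_kummerPoly hμ]
  split_ifs with hmn
  · subst hmn
    have := risingFactorial_pos hc m
    have := Real.Gamma_pos_of_pos hc
    rw [hermiteCoeff_mul_self hc]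
    generalize Real.Gamma (μ + 1 / 2) = Γ at *
    generalize μ + 1 / 2 = c at *
    field_simp
  · rw [mul_zero]

lemma integral_hermiteFun_mul_hermiteFun (hμ : -(1 / 2) < μ) (m n : ℕ) :
    ∫ t, hermiteFun μ m t * hermiteFun μ n t ∂weightMeasure μ = if m = n then 1 else 0 := by
  have hodd (hmn : Odd (m + n)) :
      ∫ t, hermiteFun μ m t * hermiteFun μ n t ∂weightMeasure μ = if m = n then 1 else 0 := by
    rw [if_neg (by rintro rfl; exact Nat.not_odd_iff_even.2 ⟨m, rfl⟩ hmn)]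
    refine integral_weightMeasure_eq_zero_of_odd μ fun t => ?_
    have hsign : (-1 : ℝ) ^ m * (-1) ^ n = -1 := by rw [← pow_add, hmn.neg_one_pow]
    rw [hermiteFun_neg, hermiteFun_neg]
    linear_combination hermiteFun μ m t * hermiteFun μ n t * hsign
  obtain hm | hm := m.even_or_odd <;> obtain hn | hn := n.even_or_odd
  · obtain ⟨k, rfl⟩ := hm.two_dvd
    obtain ⟨l, rfl⟩ := hn.two_dvd
    simpa using integral_hermiteFun_two_mul_mul_hermiteFun_two_mul hμ k l
  · exact hodd (hm.add_odd hn)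
  · exact hodd (hm.add_even hn)
  · obtain ⟨k, rfl⟩ := hm
    obtain ⟨l, rfl⟩ := hn
    have hprod (t : ℝ) : hermiteFun μ (2 * k + 1) t * hermiteFun μ (2 * l + 1) t =
        t ^ 2 • (hermiteFun (μ + 1) (2 * k) t * hermiteFun (μ + 1) (2 * l) t) := by
      rw [hermiteFun_two_mul_add_one hμ, hermiteFun_two_mul_add_one hμ, smul_eq_mul]
      ring
    simp only [hprod]
    rw [integral_sq_smul_weightMeasure,
      integral_hermiteFun_two_mul_mul_hermiteFun_two_mul (by linarith)]
    simp

end Orthonormality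

section Span

variable {μ : ℝ}

lemma ofReal_binomialTransform_mem {X : Type*} {S : Submodule ℂ (X → ℂ)} {g : ℕ → X → ℝ}
    (hg : ∀ k, (fun x => (g k x : ℂ)) ∈ S) (b : ℕ → ℝ) (m : ℕ) :
    (fun x => ((binomialTransform (fun k => b k * g k x) m : ℝ) : ℂ)) ∈ S := by
  have hsum : (fun x => ((binomialTransform (fun k => b k * g k x) m : ℝ) : ℂ)) =
      ∑ k ∈ range (m + 1), ((m.choose k : ℂ) * b k) • fun x => (g k x : ℂ) := by
    ext x
    simp [binomialTransform, mul_assoc]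
  rw [hsum]
  exact S.sum_mem fun k _ => S.smul_mem _ (hg k)

lemma pow_mul_hermiteFun_two_mul (hμ : -(1 / 2) < μ) (j m : ℕ) (x : ℝ) :
    x ^ j * hermiteFun μ (2 * m) x = binomialTransform (fun k =>
      hermiteCoeff (μ + 1 / 2) m * (-1) ^ k / risingFactorial (μ + 1 / 2) k *
        (Real.exp (-(1 / 2) * x ^ 2) * x ^ (2 * k + j))) m := by
  rw [hermiteFun_two_mul hμ, kummerPoly, ← mul_assoc, ← mul_assoc, ← binomialTransform_const_mul]
  refine binomialTransform_congr fun k _ => ?_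
  rw [neg_pow (x ^ 2), ← pow_mul, pow_add]
  ring

lemma exp_mul_pow_two_mul_add (hμ : -(1 / 2) < μ) (j m : ℕ) (x : ℝ) :
    Real.exp (-(1 / 2) * x ^ 2) * x ^ (2 * m + j) = binomialTransform (fun i =>
      risingFactorial (μ + 1 / 2) m * (-1) ^ i / hermiteCoeff (μ + 1 / 2) i *
        (x ^ j * hermiteFun μ (2 * i) x)) m := by
  have hc : 0 < μ + 1 / 2 := by linarith
  have hterm (i : ℕ) : risingFactorial (μ + 1 / 2) m * (-1) ^ i / hermiteCoeff (μ + 1 / 2) i *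
      (x ^ j * hermiteFun μ (2 * i) x) =
        risingFactorial (μ + 1 / 2) m * (x ^ j * Real.exp (-(1 / 2) * x ^ 2)) *
          ((-1) ^ i * binomialTransform
            (fun k => (-x ^ 2) ^ k / risingFactorial (μ + 1 / 2) k) i) := by
    have := hermiteCoeff_ne_zero hc i
    rw [hermiteFun_two_mul hμ, kummerPoly]
    generalize μ + 1 / 2 = c at *
    field_simp
  have hsign : (-1 : ℝ) ^ m * (-1) ^ m = 1 := by simp [← mul_pow]
  have := (risingFactorial_pos hc m).ne'
  simp only [hterm]
  rw [binomialTransform_const_mul, binomialTransform_binomialTransform_neg_one, neg_pow (x ^ 2),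
    mul_div_assoc, ← mul_assoc ((-1) ^ m), hsign, pow_add, ← pow_mul]
  generalize μ + 1 / 2 = c at *
  field_simp

lemma exp_mul_pow_mem_fourierDomain (n : ℕ) :
    (fun x : ℝ => ((Real.exp (-(1 / 2) * x ^ 2) * x ^ n : ℝ) : ℂ)) ∈ fourierDomain :=
  Submodule.subset_span ⟨n, rfl⟩

lemma hermiteFun_mem_fourierDomain (hμ : -(1 / 2) < μ) (n : ℕ) :
    (fun x => (hermiteFun μ n x : ℂ)) ∈ fourierDomain := by
  obtain ⟨m, rfl | rfl⟩ := n.even_or_odd'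
  · have h := pow_mul_hermiteFun_two_mul hμ 0 m
    simp only [pow_zero, one_mul] at h
    simp only [h]
    exact ofReal_binomialTransform_mem (fun k => exp_mul_pow_mem_fourierDomain (2 * k)) _ m
  · have h := pow_mul_hermiteFun_two_mul (μ := μ + 1) (by linarith) 1 m
    simp only [pow_one, ← hermiteFun_two_mul_add_one hμ] at h
    simp only [h]
    exact ofReal_binomialTransform_mem (fun k => exp_mul_pow_mem_fourierDomain (2 * k + 1)) _ m

lemma exp_mul_pow_mem_span_hermiteFun (hμ : -(1 / 2) < μ) (n : ℕ) :
    (fun x : ℝ => ((Real.exp (-(1 / 2) * x ^ 2) * x ^ n : ℝ) : ℂ)) ∈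
      Submodule.span ℂ (Set.range fun n x => (hermiteFun μ n x : ℂ)) := by
  obtain ⟨m, rfl | rfl⟩ := n.even_or_odd'
  · have h := exp_mul_pow_two_mul_add hμ 0 m
    simp only [pow_zero, one_mul, add_zero] at h
    simp only [h]
    exact ofReal_binomialTransform_mem
      (fun i => Submodule.subset_span (Set.mem_range_self (2 * i))) _ m
  · have h := exp_mul_pow_two_mul_add (μ := μ + 1) (by linarith) 1 m
    simp only [pow_one, ← hermiteFun_two_mul_add_one hμ] at h
    simp only [h]
    exact ofReal_binomialTransform_mem
      (fun i => Submodule.subset_span (Set.mem_range_self (2 * i + 1))) _ m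

lemma span_hermiteFun (hμ : -(1 / 2) < μ) :
    Submodule.span ℂ (Set.range fun n x => (hermiteFun μ n x : ℂ)) = fourierDomain := by
  refine le_antisymm (Submodule.span_le.2 ?_) (Submodule.span_le.2 ?_)
  · rintro _ ⟨n, rfl⟩
    exact hermiteFun_mem_fourierDomain hμ n
  · rintro _ ⟨n, rfl⟩
    exact exp_mul_pow_mem_span_hermiteFun hμ n

end Span

section Completeness

variable {μ : ℝ}

lemma memLp_of_mem_fourierDomain (hμ : -(1 / 2) < μ) {p : ENNReal} (hp : p ≠ 0) (hp' : p ≠ ⊤)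
    {f : ℝ → ℂ} (hf : f ∈ fourierDomain) : MemLp f p (weightMeasure μ) := by
  simpa using memLp_exp_mul_of_mem_fourierDomain hμ hp hp' hf 0

lemma memLp_hermiteFun (hμ : -(1 / 2) < μ) (n : ℕ) :
    MemLp (fun x => (hermiteFun μ n x : ℂ)) 2 (weightMeasure μ) :=
  memLp_of_mem_fourierDomain hμ two_ne_zero ENNReal.ofNat_ne_top
    (hermiteFun_mem_fourierDomain hμ n)

lemma inner_hermiteFun_toLp (hμ : -(1 / 2) < μ) (n : ℕ) (f : Lp ℂ 2 (weightMeasure μ)) :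
    inner ℂ (memLp_hermiteFun hμ n).toLp f =
      ∫ t, (hermiteFun μ n t : ℂ) * f t ∂weightMeasure μ := by
  rw [L2.inner_def]
  refine integral_congr_ae ?_
  filter_upwards [(memLp_hermiteFun hμ n).coeFn_toLp] with t ht
  rw [ht, RCLike.inner_apply, Complex.conj_ofReal, mul_comm]

lemma orthonormal_hermiteFun (hμ : -(1 / 2) < μ) :
    Orthonormal ℂ fun n => (memLp_hermiteFun hμ n).toLp := by
  refine orthonormal_iff_ite.2 fun m n => ?_
  have hcoe : (fun t => (hermiteFun μ m t : ℂ) * (memLp_hermiteFun hμ n).toLp _ t)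
      =ᵐ[weightMeasure μ] fun t => ((hermiteFun μ m t * hermiteFun μ n t : ℝ) : ℂ) := by
    filter_upwards [(memLp_hermiteFun hμ n).coeFn_toLp] with t ht
    rw [ht, Complex.ofReal_mul]
  rw [inner_hermiteFun_toLp hμ, integral_congr_ae hcoe, integral_complex_ofReal,
    integral_hermiteFun_mul_hermiteFun hμ]
  split_ifs <;> simp

lemma ae_eq_zero_of_forall_mem_fourierDomain (hμ : -(1 / 2) < μ) {f : ℝ → ℂ}
    (hf : MemLp f 2 (weightMeasure μ))
    (horth : ∀ g ∈ fourierDomain, ∫ t, g t * f t ∂weightMeasure μ = 0) :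
    f =ᵐ[weightMeasure μ] 0 := by
  have hzero := ae_eq_zero_of_moments_eq_zero (ν := weightMeasure μ)
    (h := fun t => (Real.exp (-(1 / 2) * t ^ 2) : ℂ) * f t) (fun b => ?_) fun n => ?_
  · filter_upwards [hzero] with t ht
    exact (mul_eq_zero.1 ht).resolve_left (by exact_mod_cast (Real.exp_pos _).ne')
  · refine ((memLp_exp_mul_of_mem_fourierDomain hμ two_ne_zero ENNReal.ofNat_ne_top
      (exp_mul_pow_mem_fourierDomain 0) b).integrable_mul hf).congr (.of_forall fun t => ?_)
    simp [mul_assoc]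
  · rw [← horth _ (exp_mul_pow_mem_fourierDomain n)]
    refine integral_congr_ae (.of_forall fun t => ?_)
    push_cast
    ring

lemma topologicalClosure_span_hermiteFun (hμ : -(1 / 2) < μ) :
    (Submodule.span ℂ (Set.range fun n => (memLp_hermiteFun hμ n).toLp)).topologicalClosure =
      ⊤ := by
  rw [Submodule.topologicalClosure_eq_top_iff, Submodule.eq_bot_iff]
  intro f hf
  have hf2 := Lp.memLp f
  rw [Lp.eq_zero_iff_ae_eq_zero]
  refine ae_eq_zero_of_forall_mem_fourierDomain hμ hf2 fun g hg => ?_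
  have hint {g : ℝ → ℂ} (hg : g ∈ fourierDomain) :
      Integrable (fun t => g t * f t) (weightMeasure μ) :=
    (memLp_of_mem_fourierDomain hμ two_ne_zero ENNReal.ofNat_ne_top hg).integrable_mul hf2
  rw [← span_hermiteFun hμ] at hg hint
  induction hg using Submodule.span_induction with
  | mem g hg =>
    obtain ⟨n, rfl⟩ := hg
    rw [← inner_hermiteFun_toLp hμ]
    exact (Submodule.mem_orthogonal _ f).1 hf _ (Submodule.subset_span ⟨n, rfl⟩)
  | zero => simp
  | add g h hg hh hg0 hh0 =>
    simp only [Pi.add_apply, add_mul]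
    rw [integral_add (hint hg) (hint hh), hg0, hh0, add_zero]
  | smul c g _ hg0 =>
    simp only [Pi.smul_apply, smul_eq_mul, mul_assoc]
    rw [integral_const_mul, hg0, mul_zero]

end Completeness

section FourierTransform

variable {μ : ℝ}

lemma integral_sq_pow_mul_hermiteFun_two_mul (hμ : -(1 / 2) < μ) (m q : ℕ) :
    ∫ t, (t ^ 2) ^ q * hermiteFun μ (2 * m) t ∂weightMeasure μ =
      2 ^ (μ + 1 / 2) * Real.Gamma (μ + 1 / 2) * ((-1) ^ m * hermiteCoeff (μ + 1 / 2) m) *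
        (2 ^ q * risingFactorial (μ + 1 / 2) q * binomialTransform
          (fun l => m.descFactorial l * (2 ^ l / risingFactorial (μ + 1 / 2) l)) q) := by
  have hfactor (t : ℝ) : (t ^ 2) ^ q * hermiteFun μ (2 * m) t = hermiteCoeff (μ + 1 / 2) m *
      ((t ^ 2) ^ q * (kummerPoly (μ + 1 / 2) (t ^ 2) m * Real.exp (-(1 / 2) * t ^ 2))) := by
    rw [hermiteFun_two_mul hμ]
    ring
  have hsign : binomialTransform (fun l => (-(1 / 2)⁻¹) ^ l * (1 - (1 / 2)⁻¹) ^ (m - l) *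
      (q.descFactorial l / risingFactorial (μ + 1 / 2) l)) m =
        (-1) ^ m * binomialTransform
          (fun l => (q.descFactorial l : ℝ) * (2 ^ l / risingFactorial (μ + 1 / 2) l)) m := by
    rw [← binomialTransform_const_mul]
    refine binomialTransform_congr fun l hl => ?_
    rw [← pow_mul_pow_sub (-1 : ℝ) hl]
    norm_num
    rw [neg_pow (2 : ℝ)]
    ring
  simp only [hfactor]
  rw [integral_const_mul, integral_sq_pow_mul_kummerPoly_mul_gaussian hμ one_half_pos, hsign,
    binomialTransform_descFactorial_comm, one_div, inv_inv, Real.inv_rpow zero_le_two,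
    Real.rpow_neg zero_le_two, inv_inv]
  ring

lemma hasSum_integral_sq_pow_mul_hermiteFun_two_mul (hμ : -(1 / 2) < μ) (m : ℕ) (x : ℝ) :
    HasSum (fun q => 1 / (gammaMu μ (2 * q) : ℂ) * (-(x : ℂ) ^ 2) ^ q *
        (∫ t, (t ^ 2) ^ q * hermiteFun μ (2 * m) t ∂weightMeasure μ : ℝ))
      (((2 ^ (μ + 1 / 2) * Real.Gamma (μ + 1 / 2) : ℝ) : ℂ) *
        ((-1) ^ m * (hermiteFun μ (2 * m) x : ℂ))) := by
  have hc : 0 < μ + 1 / 2 := by linarith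
  have hpoly := hasSum_exp_mul_binomialTransform (hasSum_pow_div_factorial_mul_descFactorial
    (-(x : ℂ) ^ 2 / 2) (fun l => 2 ^ l / risingFactorial ((μ + 1 / 2 : ℝ) : ℂ) l) m)
  have hvalue : binomialTransform (fun l => (-(x : ℂ) ^ 2 / 2) ^ l *
      (2 ^ l / risingFactorial ((μ + 1 / 2 : ℝ) : ℂ) l)) m =
        kummerPoly ((μ + 1 / 2 : ℝ) : ℂ) (x ^ 2) m := by
    refine binomialTransform_congr fun l _ => ?_
    rw [div_pow]
    field_simp
  have hsum := hpoly.mul_left ((2 ^ (μ + 1 / 2) * Real.Gamma (μ + 1 / 2) *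
    ((-1) ^ m * hermiteCoeff (μ + 1 / 2) m) : ℝ) : ℂ)
  have hφ : ((2 ^ (μ + 1 / 2) * Real.Gamma (μ + 1 / 2) : ℝ) : ℂ) *
      ((-1) ^ m * hermiteFun μ (2 * m) x) =
        (2 ^ (μ + 1 / 2) * Real.Gamma (μ + 1 / 2) * ((-1) ^ m * hermiteCoeff (μ + 1 / 2) m) : ℝ) *
          (Complex.exp (-(x : ℂ) ^ 2 / 2) * kummerPoly ((μ + 1 / 2 : ℝ) : ℂ) (x ^ 2) m) := by
    have hexp : -(x : ℂ) ^ 2 / 2 = -(1 / 2) * (x : ℂ) ^ 2 := by ring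
    rw [hermiteFun_two_mul hμ, hexp]
    push_cast
    ring
  rw [hφ, ← hvalue]
  refine hsum.congr_fun fun q => ?_
  have := risingFactorial_ofReal_ne_zero hc q
  have := q.factorial_ne_zero
  rw [integral_sq_pow_mul_hermiteFun_two_mul hμ, gammaMu_two_mul hμ, pow_mul, div_pow,
    show (2 : ℝ) ^ 2 = 2 * 2 by norm_num, mul_pow]
  generalize μ + 1 / 2 = c at *
  push_cast [binomialTransform]
  field_simp

lemma neg_I_mul_pow_two_mul (z : ℂ) (q : ℕ) : (-Complex.I * z) ^ (2 * q) = (-z ^ 2) ^ q := by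
  rw [pow_mul, mul_pow, neg_sq, Complex.I_sq, neg_one_mul]

lemma hasSum_integral_pow_mul_hermiteFun_two_mul (hμ : -(1 / 2) < μ) (m : ℕ) (x : ℝ) :
    HasSum (fun k => 1 / (gammaMu μ k : ℂ) * (-Complex.I * x) ^ k *
        ∫ t : ℝ, (t : ℂ) ^ k * (hermiteFun μ (2 * m) t : ℂ) ∂weightMeasure μ)
      (((2 ^ (μ + 1 / 2) * Real.Gamma (μ + 1 / 2) : ℝ) : ℂ) *
        ((-1) ^ m * (hermiteFun μ (2 * m) x : ℂ))) := by
  have hodd (q : ℕ) : ∫ t : ℝ, (t : ℂ) ^ (2 * q + 1) * (hermiteFun μ (2 * m) t : ℂ)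
      ∂weightMeasure μ = 0 :=
    integral_pow_mul_hermiteFun_of_odd μ (by simp [parity_simps])
  have hsum := (hasSum_integral_sq_pow_mul_hermiteFun_two_mul hμ m x).congr_fun
    (g := fun q => 1 / (gammaMu μ (2 * q) : ℂ) * (-Complex.I * x) ^ (2 * q) *
      ∫ t : ℝ, (t : ℂ) ^ (2 * q) * (hermiteFun μ (2 * m) t : ℂ) ∂weightMeasure μ) fun q => by
    rw [neg_I_mul_pow_two_mul, ← integral_complex_ofReal]
    simp only [pow_mul, Complex.ofReal_mul, Complex.ofReal_pow]
  exact hasSum_of_odd_eq_zero (fun q => by rw [hodd, mul_zero]) hsum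

lemma two_rpow_mul_Gamma_add_one (hμ : -(1 / 2) < μ) :
    2 ^ (μ + 1 + 1 / 2) * Real.Gamma (μ + 1 + 1 / 2) =
      (2 * μ + 1) * (2 ^ (μ + 1 / 2) * Real.Gamma (μ + 1 / 2)) := by
  rw [Gamma_add_one_add_half hμ, add_right_comm, Real.rpow_add_one two_ne_zero]
  ring

lemma hasSum_integral_pow_mul_hermiteFun_two_mul_add_one (hμ : -(1 / 2) < μ) (m : ℕ) (x : ℝ) :
    HasSum (fun k => 1 / (gammaMu μ k : ℂ) * (-Complex.I * x) ^ k *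
        ∫ t : ℝ, (t : ℂ) ^ k * (hermiteFun μ (2 * m + 1) t : ℂ) ∂weightMeasure μ)
      (((2 ^ (μ + 1 / 2) * Real.Gamma (μ + 1 / 2) : ℝ) : ℂ) *
        (-Complex.I * (-1) ^ m * (hermiteFun μ (2 * m + 1) x : ℂ))) := by
  have heven (q : ℕ) : ∫ t : ℝ, (t : ℂ) ^ (2 * q) * (hermiteFun μ (2 * m + 1) t : ℂ)
      ∂weightMeasure μ = 0 :=
    integral_pow_mul_hermiteFun_of_odd μ (by simp [parity_simps])
  have hshift (t : ℝ) (q : ℕ) : (t : ℂ) ^ (2 * q + 1) * (hermiteFun μ (2 * m + 1) t : ℂ) =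
      t ^ 2 • (((t ^ 2) ^ q * hermiteFun (μ + 1) (2 * m) t : ℝ) : ℂ) := by
    rw [hermiteFun_two_mul_add_one hμ, Complex.real_smul, pow_succ, pow_mul]
    push_cast
    ring
  have hsum := ((hasSum_integral_sq_pow_mul_hermiteFun_two_mul (μ := μ + 1) (by linarith) m
    x).mul_left (-Complex.I * x / (2 * μ + 1 : ℝ))).congr_fun
    (g := fun q => 1 / (gammaMu μ (2 * q + 1) : ℂ) * (-Complex.I * x) ^ (2 * q + 1) *
      ∫ t : ℝ, (t : ℂ) ^ (2 * q + 1) * (hermiteFun μ (2 * m + 1) t : ℂ) ∂weightMeasure μ)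
    fun q => by
      simp only [hshift]
      rw [integral_sq_smul_weightMeasure, integral_complex_ofReal, pow_succ,
        neg_I_mul_pow_two_mul, gammaMu_two_mul_add_one hμ,
        Complex.ofReal_mul]
      ring
  have hμ0 : ((2 * μ + 1 : ℝ) : ℂ) ≠ 0 := by exact_mod_cast (by linarith : 2 * μ + 1 ≠ 0)
  have hvalue : -Complex.I * x / (2 * μ + 1 : ℝ) *
      (((2 ^ (μ + 1 + 1 / 2) * Real.Gamma (μ + 1 + 1 / 2) : ℝ) : ℂ) *
        ((-1) ^ m * (hermiteFun (μ + 1) (2 * m) x : ℂ))) =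
      ((2 ^ (μ + 1 / 2) * Real.Gamma (μ + 1 / 2) : ℝ) : ℂ) *
        (-Complex.I * (-1) ^ m * (hermiteFun μ (2 * m + 1) x : ℂ)) := by
    rw [two_rpow_mul_Gamma_add_one hμ, Complex.ofReal_mul, hermiteFun_two_mul_add_one hμ,
      Complex.ofReal_mul x]
    field_simp
  rw [← hvalue]
  exact hasSum_of_even_eq_zero (fun q => by rw [heven, mul_zero]) hsum

lemma hasSum_integral_pow_mul_hermiteFun (hμ : -(1 / 2) < μ) (n : ℕ) (x : ℝ) :
    HasSum (fun k => 1 / (gammaMu μ k : ℂ) * (-Complex.I * x) ^ k *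
        ∫ t : ℝ, (t : ℂ) ^ k * (hermiteFun μ n t : ℂ) ∂weightMeasure μ)
      (((2 ^ (μ + 1 / 2) * Real.Gamma (μ + 1 / 2) : ℝ) : ℂ) *
        ((-Complex.I) ^ n * (hermiteFun μ n x : ℂ))) := by
  have hI (m : ℕ) : (-Complex.I) ^ (2 * m) = (-1) ^ m := by rw [pow_mul, neg_sq, Complex.I_sq]
  obtain ⟨m, rfl | rfl⟩ := n.even_or_odd'
  · rw [hI]
    exact hasSum_integral_pow_mul_hermiteFun_two_mul hμ m x
  · rw [pow_succ', hI]
    exact hasSum_integral_pow_mul_hermiteFun_two_mul_add_one hμ m x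

lemma norm_one_div_gammaMu_le (hμ : -(1 / 2) < μ) (n : ℕ) :
    ‖1 / (gammaMu μ n : ℂ)‖ ≤ (min 1 (2 * μ + 1))⁻¹ ^ n / n ! := by
  have hr : 0 < min 1 (2 * μ + 1) := lt_min one_pos (by linarith)
  rw [norm_div, norm_one, Complex.norm_real, Real.norm_of_nonneg (gammaMu_pos hμ n).le, inv_pow,
    inv_eq_one_div, div_div]
  exact one_div_le_one_div_of_le (by positivity) (pow_mul_factorial_le_gammaMu hμ n)

lemma fourierMu_hermiteFun (hμ : -(1 / 2) < μ) (n : ℕ) (x : ℝ) :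
    Integrable (fourierIntegrand μ (fun t => (hermiteFun μ n t : ℂ)) x) ∧
      fourierMu μ (fun t => (hermiteFun μ n t : ℂ)) x =
        (-Complex.I) ^ n * (hermiteFun μ n x : ℂ) := by
  have hintegrand (t : ℝ) : fourierIntegrand μ (fun t => (hermiteFun μ n t : ℂ)) x t =
      |t| ^ (2 * μ) • (expMu μ (-Complex.I * x * t) * hermiteFun μ n t) := by
    rw [fourierIntegrand, Complex.real_smul, mul_comm]
  have hseries (z : ℂ) : HasSum (fun n => 1 / (gammaMu μ n : ℂ) * z ^ n) (expMu μ z) := by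
    simpa only [one_div_mul_eq_div] using hasSum_expMu hμ z
  obtain ⟨hint, hsum⟩ := integrable_and_hasSum_integral_of_exponentialType
    (norm_one_div_gammaMu_le hμ) hseries (fun b => memLp_one_iff_integrable.1
      (memLp_exp_mul_of_mem_fourierDomain hμ one_ne_zero ENNReal.one_ne_top
        (hermiteFun_mem_fourierDomain hμ n) b)) (-Complex.I * x)
  have hconst : ((2 ^ (μ + 1 / 2) * Real.Gamma (μ + 1 / 2) : ℝ) : ℂ) ≠ 0 := by
    have := Real.Gamma_pos_of_pos (s := μ + 1 / 2) (by linarith)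
    exact_mod_cast (by positivity : (0 : ℝ) < 2 ^ (μ + 1 / 2) * Real.Gamma (μ + 1 / 2)).ne'
  refine ⟨((integrable_weightMeasure_iff μ).1 hint).congr
    (.of_forall fun t => (hintegrand t).symm), ?_⟩
  rw [fourierMu, integral_congr_ae (.of_forall hintegrand), ← integral_weightMeasure,
    hsum.unique (hasSum_integral_pow_mul_hermiteFun hμ n x), inv_mul_cancel_left₀ hconst]

end FourierTransform

end GenHermite

end

theorem mainTheorem5 (μ : ℝ) (hμ : -(1 / 2) < μ) :
    -- the generalized Hermite functions form a complete orthonormal set in `L²_μ(ℝ)`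
    (∃ hL2 : ∀ n : ℕ,
        MemLp (fun x : ℝ => (GenHermite.hermiteFun μ n x : ℂ)) 2 (GenHermite.weightMeasure μ),
      Orthonormal ℂ (fun n : ℕ => (hL2 n).toLp) ∧
      (Submodule.span ℂ (Set.range fun n : ℕ => (hL2 n).toLp)).topologicalClosure = ⊤) ∧
    -- they lie in the domain of the generalized Fourier transform and are eigenfunctions of it
    (∀ n : ℕ,
      (fun x : ℝ => (GenHermite.hermiteFun μ n x : ℂ)) ∈ GenHermite.fourierDomain ∧
      ∀ x : ℝ,
        Integrable
          (GenHermite.fourierIntegrand μ (fun t : ℝ => (GenHermite.hermiteFun μ n t : ℂ)) x) ∧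
        GenHermite.fourierMu μ (fun t : ℝ => (GenHermite.hermiteFun μ n t : ℂ)) x =
          (-Complex.I) ^ n * (GenHermite.hermiteFun μ n x : ℂ)) ∧
    -- Mehler formula
    (∀ (x y : ℝ) (z : ℂ), ‖z‖ < 1 →
      HasSum
        (fun n : ℕ =>
          (GenHermite.hermiteFun μ n x : ℂ) * (GenHermite.hermiteFun μ n y : ℂ) * z ^ n)
        (1 / (Real.Gamma (μ + 1 / 2) : ℂ) *
          (1 / (1 - z ^ 2) ^ ((μ : ℂ) + 1 / 2)) *
          Complex.exp (-(1 / 2) * ((x : ℂ) ^ 2 + (y : ℂ) ^ 2) * ((1 + z ^ 2) / (1 - z ^ 2))) *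
          GenHermite.expMu μ (2 * (x : ℂ) * (y : ℂ) * (z / (1 - z ^ 2))))) :=
  ⟨⟨GenHermite.memLp_hermiteFun hμ, GenHermite.orthonormal_hermiteFun hμ,
      GenHermite.topologicalClosure_span_hermiteFun hμ⟩,
    fun n => ⟨GenHermite.hermiteFun_mem_fourierDomain hμ n, GenHermite.fourierMu_hermiteFun hμ n⟩,
    fun x y _ hz => GenHermite.hasSum_hermiteFun_mul hμ x y hz⟩
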